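/- Let $T$ be an infinite, locally finite rooted tree with root $v_0$. Let $\partial T$ be its space of ends, that is, the set of infinite paths $\xi=(\xi_n)_{n\ge 0}$ with $\xi_0=v_0$ such that $\xi_{n+1}$ is a child of $\xi_n$ for every $n$, with the visual metric $d(\xi,\xi')=2^{-N}$ for $\xi\neq\xi'$, where $N$ is the smallest $n$ with $\xi_n\ne\xi'_n$; this is a compact metric space. Let $\mathrm{AAut}(T)$ be the group of almost automorphisms of $T$, i.e. of homeomorphisms $g$ of $\partial T$ for which there are a finite partition of $\partial T$ into balls $D_1,\dots,D_n$ of the form $\partial T_v=\{\xi : v\in\xi\}$ ($v$ a vertex) and numbers $\lambda_1,\dots,\lambda_n>0$ with $d(g(y),g(z))=\lambda_j\,d(y,z)$ for all $y,z\in D_j$ and all $j$. Then the action of $\mathrm{AAut}(T)$ on $\partial T$ satisfies the dynamical Tits alternative: for every subgroup $H\le \mathrm{AAut}(T)$, either $H$ preserves a regular Borel probability measure on $\partial T$, or there is a ping-pong pair $g,h\in H$ on $\partial T$, i.e. there are pairwise disjoint open sets $U_1,U_2,V_1,V_2\subseteq\partial T$ such that $$g(\partial T\setminus U_1)\subseteq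 V_1\quad\text{and}\quad h(\partial T\setminus U_2)\subseteq V_2 .$$ Moreover, any ping-pong pair $g,h\in\mathrm{AAut}(T)$ on $\partial T$ freely generates a free group of rank two. -/

import Mathlib

open MeasureTheory Topology

/-! ### The dynamical Tits alternative -/

section Dynamics

variable {X : Type*} [TopologicalSpace X]

/-- `g, h` is a ping-pong pair on `X`: there are pairwise disjoint open sets `U₁, U₂, V₁, V₂` with
`g (X \ U₁) ⊆ V₁` and `h (X \ U₂) ⊆ V₂`. -/
def IsPingPongPair (g h : X ≃ₜ X) : Prop :=
  ∃ U₁ U₂ V₁ V₂ : Set X,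
    (IsOpen U₁ ∧ IsOpen U₂ ∧ IsOpen V₁ ∧ IsOpen V₂) ∧
    [U₁, U₂, V₁, V₂].Pairwise Disjoint ∧
    g '' U₁ᶜ ⊆ V₁ ∧ h '' U₂ᶜ ⊆ V₂

/-- A group of homeomorphisms of `X` preserves some regular Borel probability measure on `X`. -/
def PreservesRegularProbability [MeasurableSpace X] [BorelSpace X] (H : Subgroup (X ≃ₜ X)) :
    Prop :=
  ∃ μ : Measure X, IsProbabilityMeasure μ ∧ μ.Regular ∧ ∀ h ∈ H, μ.map h = μ

/-- The dynamical Tits alternative for a group `G` of homeomorphisms of a compact space `X`. -/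
def DynamicalTitsAlternative [CompactSpace X] [MeasurableSpace X] [BorelSpace X]
    (G : Subgroup (X ≃ₜ X)) : Prop :=
  ∀ H : Subgroup (X ≃ₜ X), H ≤ G →
    PreservesRegularProbability H ∨ ∃ g ∈ H, ∃ h ∈ H, IsPingPongPair g h

end Dynamics

/-! ### The boundary of a rooted tree

In a `RootedTree` the vertices are ordered by descent from the root `⊥`, and the children of a
vertex `v` are the vertices `w` that cover it, `v ⋖ w`. -/

namespace RootedTree

/-- Every vertex has finitely many children. -/
class LocallyFinite (T : RootedTree) : Prop where
  finite_children : ∀ v : T, {w : T | v ⋖ w}.Finite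

/-- The space of ends `∂T`: infinite directed paths starting at the root. -/
@[ext]
structure Boundary (T : RootedTree) where
  /-- the sequence of vertices of the path -/
  path : ℕ → T
  path_zero : path 0 = ⊥
  path_covBy : ∀ n, path n ⋖ path (n + 1)

namespace Boundary

variable {T : RootedTree}

/-- The visual metric: the distance of `ξ ≠ ξ'` is `(1/2) ^ N`, where `N` is the smallest index
with `ξ N ≠ ξ' N` (this is `PiNat.dist`). The topology is the one given by the metric. -/
noncomputable instance : MetricSpace (Boundary T) where
  dist ξ ξ' := (PiNat.dist (E := fun _ => T)).dist ξ.path ξ'.path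
  dist_self ξ := PiNat.dist_self ξ.path
  dist_comm ξ ξ' := PiNat.dist_comm ξ.path ξ'.path
  dist_triangle ξ ξ' ξ'' := PiNat.dist_triangle ξ.path ξ'.path ξ''.path
  eq_of_dist_eq_zero h := Boundary.ext (PiNat.eq_of_dist_eq_zero _ _ h)

noncomputable instance : MeasurableSpace (Boundary T) := borel _

instance : BorelSpace (Boundary T) := ⟨rfl⟩

/-- The clopen ball `∂T_v` of all ends that pass through the vertex `v`. -/
def ball (v : T) : Set (Boundary T) := {ξ | ∃ n, ξ.path n = v}

theorem dist_def (ξ ξ' : Boundary T) :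
    dist ξ ξ' = (PiNat.dist (E := fun _ => T)).dist ξ.path ξ'.path := rfl

theorem pred_iterate (ξ : Boundary T) (n k : ℕ) : Order.pred^[k] (ξ.path (n + k)) = ξ.path n := by
  induction k with
  | zero => rfl
  | succ k ih =>
    rw [Function.iterate_succ_apply, ← add_assoc, (ξ.path_covBy (n + k)).pred_eq, ih]

theorem eq_of_le {ξ η : Boundary T} {n i : ℕ} (h : η.path n = ξ.path n) (hi : i ≤ n) :
    η.path i = ξ.path i := by
  obtain ⟨k, rfl⟩ := Nat.exists_eq_add_of_le hi
  rw [← pred_iterate η i k, ← pred_iterate ξ i k, h]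

theorem strictMono (ξ : Boundary T) : StrictMono ξ.path :=
  strictMono_nat_of_lt_succ fun n => (ξ.path_covBy n).lt

theorem level_eq {ξ η : Boundary T} {n m : ℕ} (h : η.path m = ξ.path n) : m = n := by
  rcases le_total m n with hmn | hmn
  · obtain ⟨k, rfl⟩ := Nat.exists_eq_add_of_le hmn
    have h1 := pred_iterate η 0 m
    have h2 := pred_iterate ξ k m
    rw [zero_add] at h1
    rw [add_comm k m, ← h, h1, η.path_zero, ← ξ.path_zero] at h2
    have := ξ.strictMono.injective h2
    omega
  · obtain ⟨k, rfl⟩ := Nat.exists_eq_add_of_le hmn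
    have h1 := pred_iterate ξ 0 n
    have h2 := pred_iterate η k n
    rw [zero_add] at h1
    rw [add_comm k n, h, h1, ξ.path_zero, ← η.path_zero] at h2
    have := η.strictMono.injective h2
    omega

theorem mem_ball_iff {ξ η : Boundary T} {n : ℕ} : η ∈ ball (ξ.path n) ↔ η.path n = ξ.path n := by
  constructor
  · rintro ⟨m, hm⟩
    rwa [level_eq hm] at hm
  · exact fun h => ⟨n, h⟩

theorem mem_ball_iff_dist {ξ η : Boundary T} {n : ℕ} :
    η ∈ ball (ξ.path n) ↔ dist η ξ < (1 / 2 : ℝ) ^ n := by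
  rw [mem_ball_iff]
  constructor
  · intro h
    refine lt_of_le_of_lt ((PiNat.mem_cylinder_iff_dist_le (n := n + 1)).1 ?_)
      (pow_lt_pow_right_of_lt_one₀ (by norm_num) (by norm_num) (Nat.lt_succ_self n))
    intro i hi
    exact eq_of_le h (Nat.lt_succ_iff.1 hi)
  · intro h
    exact PiNat.apply_eq_of_dist_lt (E := fun _ => T) h le_rfl

theorem finite_level [T.LocallyFinite] (n : ℕ) :
    (Set.range fun ξ : Boundary T => ξ.path n).Finite := by
  induction n with
  | zero =>
    refine (Set.finite_singleton (⊥ : T)).subset ?_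
    rintro _ ⟨ξ, rfl⟩
    exact ξ.path_zero
  | succ n ih =>
    refine (ih.biUnion fun v _ => LocallyFinite.finite_children v).subset ?_
    rintro _ ⟨ξ, rfl⟩
    exact Set.mem_biUnion ⟨ξ, rfl⟩ (ξ.path_covBy n)

instance [T.LocallyFinite] : CompactSpace (Boundary T) := by
  let _ : TopologicalSpace T := ⊥
  have _ : DiscreteTopology T := ⟨rfl⟩
  have hrange : Set.range (path : Boundary T → ℕ → T) =
      {x | x 0 = ⊥} ∩ ⋂ n, {x | x n ⋖ x (n + 1)} := by
    ext x
    simp only [Set.mem_range, Set.mem_inter_iff, Set.mem_iInter, Set.mem_ofPred_eq]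
    exact ⟨by rintro ⟨ξ, rfl⟩; exact ⟨ξ.path_zero, ξ.path_covBy⟩, fun h => ⟨⟨x, h.1, h.2⟩, rfl⟩⟩
  have hclosed : IsClosed (Set.range (path : Boundary T → ℕ → T)) := by
    rw [hrange]
    refine IsClosed.inter ?_ (isClosed_iInter fun n => ?_)
    · exact (isClosed_discrete ({⊥} : Set T)).preimage
        (continuous_apply (A := fun _ : ℕ => T) 0)
    · exact (isClosed_discrete {p : T × T | p.1 ⋖ p.2}).preimage
        ((continuous_apply (A := fun _ : ℕ => T) n).prodMk
          (continuous_apply (A := fun _ : ℕ => T) (n + 1)))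
  have hcomp : IsCompact (Set.range (path : Boundary T → ℕ → T)) := by
    refine (isCompact_univ_pi fun n => (finite_level (T := T) n).isCompact).of_isClosed_subset
      hclosed ?_
    rintro _ ⟨ξ, rfl⟩ n _
    exact ⟨ξ, rfl⟩
  let _ : MetricSpace (ℕ → T) := PiNat.metricSpace
  have hiso : Isometry (path : Boundary T → ℕ → T) := Isometry.of_dist_eq fun _ _ => rfl
  exact ⟨hiso.isEmbedding.isCompact_iff.2 (by rwa [Set.image_univ])⟩

end Boundary

/-! ### Almost automorphisms -/

open Boundary

variable {T : RootedTree}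

/-- `g` rescales the visual metric on `D` by a positive constant. -/
def IsHomothetyOn (g : Boundary T → Boundary T) (D : Set (Boundary T)) : Prop :=
  ∃ c : ℝ, 0 < c ∧ ∀ y ∈ D, ∀ z ∈ D, dist (g y) (g z) = c * dist y z

/-- `P` is a finite partition of `∂T` into clopen balls on each of which `g` is a homothety. -/
def IsAdmissible (g : Boundary T ≃ₜ Boundary T) (P : Set (Set (Boundary T))) : Prop :=
  P.Finite ∧ Setoid.IsPartition P ∧ ∀ D ∈ P, (∃ v : T, D = ball v) ∧ IsHomothetyOn g D

/-- `g` is an almost automorphism of `T`. -/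
def IsAlmostAutomorphism (g : Boundary T ≃ₜ Boundary T) : Prop :=
  ∃ P, IsAdmissible g P

theorem IsHomothetyOn.mono {g : Boundary T → Boundary T} {D E : Set (Boundary T)}
    (h : IsHomothetyOn g D) (hE : E ⊆ D) : IsHomothetyOn g E := by
  obtain ⟨c, hc, h⟩ := h
  exact ⟨c, hc, fun y hy z hz => h y (hE hy) z (hE hz)⟩

theorem isAlmostAutomorphism_iff [T.LocallyFinite] {g : Boundary T ≃ₜ Boundary T} :
    IsAlmostAutomorphism g ↔ ∀ ξ, ∃ U ∈ 𝓝 ξ, IsHomothetyOn g U := by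
  constructor
  · rintro ⟨P, -, hP, h⟩ ξ
    obtain ⟨D, ⟨hD, hξ⟩, -⟩ := hP.2 ξ
    obtain ⟨⟨v, rfl⟩, hg⟩ := h D hD
    refine ⟨ball v, ?_, hg⟩
    obtain ⟨n, rfl⟩ := hξ
    refine Filter.mem_of_superset (Metric.ball_mem_nhds ξ (ε := (1 / 2 : ℝ) ^ n) (by positivity)) ?_
    exact fun η hη => mem_ball_iff_dist.2 hη
  · intro h
    choose U hU hg using h
    obtain ⟨δ, hδ, hL⟩ := lebesgue_number_lemma_of_metric (s := (Set.univ : Set (Boundary T)))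
      (c := fun ξ => interior (U ξ)) isCompact_univ (fun ξ => isOpen_interior)
      (fun ξ _ => Set.mem_iUnion.2 ⟨ξ, mem_interior_iff_mem_nhds.2 (hU ξ)⟩)
    obtain ⟨n, hn⟩ := exists_pow_lt_of_lt_one hδ (by norm_num : (1 / 2 : ℝ) < 1)
    refine ⟨Set.range fun ξ : Boundary T => ball (ξ.path n), ?_, ⟨?_, ?_⟩, ?_⟩
    · have := (finite_level (T := T) n).image (ball (T := T))
      rwa [← Set.range_comp] at this
    · rintro ⟨ξ, hξ⟩
      have : ξ ∈ ball (ξ.path n) := ⟨n, rfl⟩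
      simp only [hξ] at this
      exact this
    · intro ξ
      refine ⟨ball (ξ.path n), ⟨⟨ξ, rfl⟩, ⟨n, rfl⟩⟩, ?_⟩
      rintro _ ⟨⟨η, rfl⟩, hη⟩
      simp only [mem_ball_iff.1 hη]
    · rintro _ ⟨ξ, rfl⟩
      refine ⟨⟨_, rfl⟩, ?_⟩
      obtain ⟨i, hi⟩ := hL ξ trivial
      refine (hg i).mono fun η hη => interior_subset (hi ?_)
      exact (mem_ball_iff_dist.1 hη).trans hn

variable (T) in
/-- The group `AAut(T)` of almost automorphisms of `T`, acting on `∂T`. -/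
def AAut [T.LocallyFinite] : Subgroup (Boundary T ≃ₜ Boundary T) where
  carrier := {g | IsAlmostAutomorphism g}
  one_mem' := isAlmostAutomorphism_iff.2 fun ξ =>
    ⟨Set.univ, Filter.univ_mem, 1, one_pos, fun y _ z _ => (one_mul _).symm⟩
  mul_mem' := by
    intro g h hg hh
    refine isAlmostAutomorphism_iff.2 fun ξ => ?_
    obtain ⟨U, hU, c, hc, hcU⟩ := isAlmostAutomorphism_iff.1 hh ξ
    obtain ⟨W, hW, d, hd, hdW⟩ := isAlmostAutomorphism_iff.1 hg (h ξ)
    refine ⟨U ∩ h ⁻¹' W, Filter.inter_mem hU (h.continuous.continuousAt hW), d * c,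
      mul_pos hd hc, fun y hy z hz => ?_⟩
    rw [Homeomorph.mul_apply, Homeomorph.mul_apply, hdW _ hy.2 _ hz.2, hcU _ hy.1 _ hz.1, mul_assoc]
  inv_mem' := by
    intro g hg
    refine isAlmostAutomorphism_iff.2 fun ξ => ?_
    obtain ⟨U, hU, c, hc, hcU⟩ := isAlmostAutomorphism_iff.1 hg (g.symm ξ)
    refine ⟨g.symm ⁻¹' U, g.symm.continuous.continuousAt hU, c⁻¹, inv_pos.2 hc,
      fun y hy z hz => ?_⟩
    have := hcU _ hy _ hz
    rw [g.apply_symm_apply, g.apply_symm_apply] at this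
    rw [Homeomorph.inv_apply, Homeomorph.inv_apply, this, inv_mul_cancel_left₀ hc.ne']

end RootedTree

/-!
The argument works for any group of local homotheties of a compact ultrametric space.

By weak-* compactness it suffices to treat a finitely generated `H` that preserves no probability
measure; its orbits are then infinite. Let `M` be a minimal set. If the scaling factors of all
elements of `H` on the balls of a fixed radius around points of `M` were bounded below, then `H`
would act equicontinuously on `M` and preserve a probability measure there. Otherwise, returning to
the initial ball after a strong contraction, one finds `g ∈ H` and two points of `M` whose images
under every positive power of `g` are closer together than the points themselves.

On the other hand, let `g` be any local homothety. There are only finitely many balls of a given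
small radius, and a ball which `g^p` maps into itself is either contracted to a periodic point or
recurrent. Applied to `g` and `g⁻¹`, this gives a clopen set `K` such that suitable positive powers
of `g` converge to the identity on `K` and collapse the complement of `K`, away from a finite set,
onto a finite set. Such a `K` cannot contain the two points found above, so the intersection of all
these sets `K` for `g ∈ H`, which is closed and invariant, is empty. By compactness finitely many of
them have empty intersection, and composing the corresponding powers collapses the whole space away
from a finite set. As the orbits are infinite, the finite attracting and repelling sets can be moved
apart, which yields the ping-pong pair.
-/

section Action

universe u

variable {X : Type u} [TopologicalSpace X]

/-- The tautological action of the homeomorphism group. -/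
instance homeomorphMulAction : MulAction (X ≃ₜ X) X where
  smul g x := g x
  one_smul _ := rfl
  mul_smul _ _ _ := rfl

theorem coe_homeomorph_pow (g : X ≃ₜ X) (n : ℕ) : ⇑(g ^ n) = g^[n] := by
  induction n with
  | zero => rfl
  | succ n ih => rw [pow_succ, Function.iterate_succ, ← ih]; rfl

theorem injective_lift_of_image_compl_subset [Nonempty X] {ι : Type u} [Nontrivial ι]
    {a : ι → X ≃ₜ X} {U V : ι → Set X} (hU : Pairwise (Function.onFun Disjoint U))
    (hV : Pairwise (Function.onFun Disjoint V)) (hUV : ∀ i j, Disjoint (U i) (V j))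
    (ha : ∀ i, a i '' (U i)ᶜ ⊆ V i) : Function.Injective (FreeGroup.lift a) := by
  have hV_nonempty : ∀ i, (V i).Nonempty := by
    intro i
    obtain ⟨j, hji⟩ := exists_ne i
    suffices hUi : U i ≠ Set.univ from
      ((Set.nonempty_compl.2 hUi).image (a i)).mono (ha i)
    intro hUi
    have hUj : U j = ∅ := by simpa [Function.onFun, hUi] using hU hji
    have hVj : V j = ∅ := by simpa [hUi] using hUV i j
    simpa [hUj, hVj] using ha j
  have ha_inv : ∀ i, (fun x => (a i)⁻¹ x) '' (V i)ᶜ ⊆ U i := by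
    rintro i _ ⟨x, hx, rfl⟩
    by_contra hxU
    exact hx (ha i ⟨_, hxU, (a i).apply_symm_apply x⟩)
  exact FreeGroup.injective_lift_of_ping_pong a V U hV_nonempty hV hU
    (fun i j => (hUV j i).symm) ha ha_inv

theorem IsPingPongPair.injective_lift [Nonempty X] {g h : X ≃ₜ X} (hgh : IsPingPongPair g h) :
    Function.Injective (FreeGroup.lift ![g, h]) := by
  obtain ⟨U₁, U₂, V₁, V₂, -, hdisj, hg, hh⟩ := hgh
  simp only [List.pairwise_cons, List.mem_cons, List.not_mem_nil, or_false, forall_eq_or_imp,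
    forall_eq, false_imp_iff, implies_true, List.Pairwise.nil, and_true] at hdisj
  obtain ⟨⟨hU, hUV, hUV'⟩, ⟨hVU, hVU'⟩, hV⟩ := hdisj
  -- Mathlib's ping-pong lemma wants the index type in the universe of the group.
  have hlift : Function.Injective (FreeGroup.lift fun i : ULift.{u} (Fin 2) => ![g, h] i.down) := by
    refine injective_lift_of_image_compl_subset (U := fun i => ![U₁, U₂] i.down)
      (V := fun i => ![V₁, V₂] i.down) ?_ ?_ ?_ ?_
    · rintro ⟨i⟩ ⟨j⟩ hij
      fin_cases i <;> fin_cases j <;> simp_all [Function.onFun, disjoint_comm]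
    · rintro ⟨i⟩ ⟨j⟩ hij
      fin_cases i <;> fin_cases j <;> simp_all [Function.onFun, disjoint_comm]
    · rintro ⟨i⟩ ⟨j⟩
      fin_cases i <;> fin_cases j <;> simp_all
    · rintro ⟨i⟩
      fin_cases i
      exacts [hg, hh]
  have hcomp : FreeGroup.lift ![g, h] =
      (FreeGroup.lift fun i : ULift.{u} (Fin 2) => ![g, h] i.down).comp
        (FreeGroup.map ULift.up) := by
    ext1 i
    simp
  rw [hcomp, MonoidHom.coe_comp]
  exact hlift.comp (FreeGroup.map_injective ULift.up_injective)

end Action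

open scoped Pointwise in
theorem exists_forall_smul_ne_of_infinite_orbit {G X : Type*} [Group G] [MulAction G X]
    {A B : Set X} (hA : A.Finite) (hB : B.Finite) (h : ∀ a ∈ A, (MulAction.orbit G a).Infinite) :
    ∃ g : G, ∀ a ∈ A, ∀ b ∈ B, g • a ≠ b := by
  classical
  -- Otherwise `G` is a finite union of the cosets `{g | g • a = b}` of stabilizers, so that, by
  -- B. H. Neumann's lemma, some stabilizer has finite index.
  by_contra! hcon
  choose f hf using fun p : {p : X × X // ∃ g : G, g • p.1 = p.2} => p.2
  let s : Finset {p : X × X // ∃ g : G, g • p.1 = p.2} :=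
    ((hA.prod hB).preimage Subtype.val_injective.injOn).toFinset
  have hcover : ⋃ p ∈ s, f p • (MulAction.stabilizer G p.1.1 : Set G) = Set.univ := by
    refine Set.eq_univ_of_forall fun g => ?_
    obtain ⟨a, ha, b, hb, hab⟩ := hcon g
    refine Set.mem_biUnion (x := ⟨(a, b), g, hab⟩) (by simp [s, ha, hb]) ?_
    rw [Set.mem_smul_set_iff_inv_smul_mem, SetLike.mem_coe, MulAction.mem_stabilizer_iff,
      smul_eq_mul, mul_smul, inv_smul_eq_iff, hf, hab]
  obtain ⟨p, hp, hindex⟩ := Subgroup.exists_finiteIndex_of_leftCoset_cover hcover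
  have hpA : p.1.1 ∈ A := ((Set.Finite.mem_toFinset _).1 hp).1
  refine h p.1.1 hpA (Set.finite_of_ncard_ne_zero ?_)
  rw [← MulAction.index_stabilizer]
  exact hindex.index_ne_zero

theorem finite_quotient_of_forall_dist_lt {X : Type*} [PseudoMetricSpace X] [CompactSpace X]
    {S : Setoid X} {η : ℝ} (hη : 0 < η) (h : ∀ x y, dist x y < η → S x y) :
    Finite (Quotient S) := by
  obtain ⟨t, -, ht, hcover⟩ := isCompact_univ.finite_cover_balls (X := X) hη
  have : Finite t := ht
  refine Finite.of_surjective (fun x : t => (⟦x.1⟧ : Quotient S)) (Quotient.ind fun y => ?_)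
  obtain ⟨x, hx, hy⟩ := Set.mem_iUnion₂.1 (hcover (Set.mem_univ y))
  exact ⟨⟨x, hx⟩, Quotient.sound (h _ _ (by rwa [dist_comm]))⟩

section InvariantMeasure

universe u

variable {X : Type u} [MetricSpace X] [CompactSpace X] [MeasurableSpace X] [BorelSpace X]

theorem preservesRegularProbability_of_tendsto {ι : Type*} (l : Filter ι) [l.NeBot]
    (μ : ι → ProbabilityMeasure X) {H : Subgroup (X ≃ₜ X)}
    (h : ∀ g ∈ H, ∀ f : BoundedContinuousFunction X ℝ,
      Filter.Tendsto (fun i => ∫ x, f (g x) ∂(μ i : Measure X) - ∫ x, f x ∂(μ i : Measure X))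
        l (𝓝 0)) :
    PreservesRegularProbability H := by
  -- The space of probability measures is weak-* compact; any limit point of `μ` is invariant.
  let U : Ultrafilter ι := Ultrafilter.of l
  obtain ⟨ν, -, hν⟩ : ∃ ν ∈ Set.univ, Filter.Tendsto μ U (𝓝 ν) :=
    isCompact_univ.ultrafilter_le_nhds (U.map μ) (by simp)
  rw [ProbabilityMeasure.tendsto_iff_forall_integral_tendsto] at hν
  refine ⟨ν, inferInstance, inferInstance, fun g hg => ?_⟩
  have : IsProbabilityMeasure ((ν : Measure X).map g) :=
    Measure.isProbabilityMeasure_map g.continuous.measurable.aemeasurable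
  refine ext_of_forall_integral_eq_of_IsFiniteMeasure fun f => ?_
  rw [integral_map g.continuous.measurable.aemeasurable f.continuous.aestronglyMeasurable]
  have hgf := hν (f.compContinuous ⟨g, g.continuous⟩)
  have hzero := (h g hg f).mono_left (Ultrafilter.of_le l)
  exact sub_eq_zero.1 (tendsto_nhds_unique (hgf.sub (hν f)) hzero)

theorem preservesRegularProbability_of_closure_finset {H : Subgroup (X ≃ₜ X)}
    (h : ∀ F : Finset (X ≃ₜ X), (F : Set (X ≃ₜ X)) ⊆ H →
      PreservesRegularProbability (Subgroup.closure (F : Set (X ≃ₜ X)))) :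
    PreservesRegularProbability H := by
  classical
  choose μ hμ _ hinv using fun F : Finset H => h (F.map (Function.Embedding.subtype _))
    (by simpa [Set.subset_def] using fun x hx _ => hx)
  refine preservesRegularProbability_of_tendsto Filter.atTop (fun F => ⟨μ F, hμ F⟩) ?_
  intro g hg f
  refine tendsto_const_nhds.congr' ?_
  filter_upwards [Filter.eventually_ge_atTop ({⟨g, hg⟩} : Finset H)] with F hF
  have hgF : g ∈ Subgroup.closure (F.map (Function.Embedding.subtype _) : Set (X ≃ₜ X)) :=
    Subgroup.subset_closure (by simpa [hg] using hF)
  have hmap := integral_map (μ := μ F) g.continuous.measurable.aemeasurable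
    (f := f) f.continuous.aestronglyMeasurable
  rw [hinv F g hgF] at hmap
  exact (sub_eq_zero.2 hmap.symm).symm

section Empirical

variable {ι : Type*} [Fintype ι] [Nonempty ι]

/-- The probability measure equidistributed over the finite family of points `p`. -/
noncomputable def empiricalMeasure (p : ι → X) : ProbabilityMeasure X :=
  ⟨((Fintype.card ι : ENNReal))⁻¹ • ∑ i, Measure.dirac (p i), ⟨by
    simp [ENNReal.inv_mul_cancel (Nat.cast_ne_zero.2 Fintype.card_ne_zero)]⟩⟩

theorem integral_empiricalMeasure (p : ι → X) {f : X → ℝ} (hf : Continuous f) :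
    ∫ x, f x ∂(empiricalMeasure p : Measure X) = (Fintype.card ι : ℝ)⁻¹ * ∑ i, f (p i) := by
  have hintegrable : ∀ i ∈ Finset.univ, Integrable f (Measure.dirac (p i)) := fun i _ =>
    hf.integrable_of_hasCompactSupport (HasCompactSupport.of_compactSpace f)
  simp [empiricalMeasure, integral_finsetSum_measure hintegrable]

theorem abs_integral_comp_sub_integral_empiricalMeasure_le {p : ι → X} {f : X → ℝ}
    (hf : Continuous f) {g : X → X} (hg : Continuous g) (σ : Equiv.Perm ι) {ε : ℝ}
    (h : ∀ i, |f (g (p i)) - f (p (σ i))| ≤ ε) :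
    |∫ x, f (g x) ∂(empiricalMeasure p : Measure X) -
      ∫ x, f x ∂(empiricalMeasure p : Measure X)| ≤ ε := by
  have hcard : (0 : ℝ) < Fintype.card ι := by exact_mod_cast Fintype.card_pos
  rw [integral_empiricalMeasure p (f := fun x => f (g x)) (hf.comp hg),
    integral_empiricalMeasure p hf,
    ← Equiv.sum_comp σ fun i => f (p i), ← mul_sub, ← Finset.sum_sub_distrib, abs_mul,
    abs_of_pos (inv_pos.2 hcard), inv_mul_le_iff₀ hcard]
  calc |∑ i, (f (g (p i)) - f (p (σ i)))| ≤ ∑ i, |f (g (p i)) - f (p (σ i))| :=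
        Finset.abs_sum_le_sum_abs _ _
    _ ≤ ∑ _i : ι, ε := Finset.sum_le_sum fun i _ => h i
    _ = Fintype.card ι * ε := by simp

end Empirical

theorem preservesRegularProbability_of_approx_permuted {H : Subgroup (X ≃ₜ X)}
    (h : ∀ ε > 0, ∃ (ι : Type u) (_ : Fintype ι) (_ : Nonempty ι) (p : ι → X),
      ∀ g ∈ H, ∃ σ : Equiv.Perm ι, ∀ i, dist (g (p i)) (p (σ i)) < ε) :
    PreservesRegularProbability H := by
  choose ι _ _ p hp using fun n : ℕ => h (1 / ((n : ℝ) + 1)) Nat.one_div_pos_of_nat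
  refine preservesRegularProbability_of_tendsto Filter.atTop (fun n => empiricalMeasure (p n))
    fun g hg f => Metric.tendsto_atTop.2 fun ε hε => ?_
  obtain ⟨η, hη, hf⟩ := Metric.uniformContinuous_iff.1
    (CompactSpace.uniformContinuous_of_continuous f.continuous) (ε / 2) (half_pos hε)
  obtain ⟨N, hN⟩ := exists_nat_one_div_lt hη
  refine ⟨N, fun n hn => ?_⟩
  obtain ⟨σ, hσ⟩ := hp n g hg
  rw [Real.dist_0_eq_abs]
  refine (abs_integral_comp_sub_integral_empiricalMeasure_le f.continuous g.continuous σ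
    fun i => ?_).trans_lt (half_lt_self hε)
  exact (hf ((hσ i).trans ((Nat.one_div_le_one_div hn).trans_lt hN))).le

theorem infinite_orbit_of_not_preservesRegularProbability {H : Subgroup (X ≃ₜ X)}
    (hH : ¬ PreservesRegularProbability H) (x : X) : (MulAction.orbit H x).Infinite := by
  intro hfin
  refine hH (preservesRegularProbability_of_approx_permuted fun ε hε =>
    ⟨MulAction.orbit H x, hfin.fintype,
      (MulAction.nonempty_orbit x).to_subtype, Subtype.val, fun g hg =>
      ⟨MulAction.toPerm (⟨g, hg⟩ : H), fun i => ?_⟩⟩)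
  change dist (g i) (g i) < ε
  rwa [dist_self]

theorem preservesRegularProbability_of_equicontinuousOn [IsUltrametricDist X]
    {H : Subgroup (X ≃ₜ X)} {M : Set X} (hMc : IsClosed M) (hM : M.Nonempty)
    (hinv : ∀ g ∈ H, Set.MapsTo g M M)
    (heq : ∀ ε > 0, ∃ η > 0, ∀ g ∈ H, ∀ x ∈ M, ∀ y ∈ M, dist x y < η → dist (g x) (g y) < ε) :
    PreservesRegularProbability H := by
  classical
  refine preservesRegularProbability_of_approx_permuted fun ε hε => ?_
  -- By the ultrametric inequality, `H` permutes the classes of this equivalence relation.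
  let S : Setoid M :=
    { r := fun x y => ∀ g ∈ H, dist (g x) (g y) < ε
      iseqv :=
        { refl := fun x g _ => by rwa [dist_self]
          symm := fun h g hg => by rw [dist_comm]; exact h g hg
          trans := fun h h' g hg =>
            (dist_triangle_max _ _ _).trans_lt (max_lt (h g hg) (h' g hg)) } }
  have : CompactSpace M := isCompact_iff_compactSpace.1 hMc.isCompact
  have : Nonempty (Quotient S) := ⟨⟦⟨_, hM.some_mem⟩⟧⟩
  have : Finite (Quotient S) := by
    obtain ⟨η, hη, h⟩ := heq ε hε
    exact finite_quotient_of_forall_dist_lt hη fun x y hxy g hg => h g hg x x.2 y y.2 hxy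
  refine ⟨Quotient S, Fintype.ofFinite _, inferInstance, fun q => (q.out : M), fun g hg => ?_⟩
  let g' : M → M := (hinv g hg).restrict
  let σ : Quotient S → Quotient S :=
    Quotient.map g' fun x y hxy k hk => hxy (k * g) (H.mul_mem hk hg)
  have hσ : Function.Injective σ := by
    refine Quotient.ind₂ fun x y hxy => Quotient.sound fun k hk => ?_
    simpa [g'] using Quotient.exact hxy (k * g⁻¹) (H.mul_mem hk (H.inv_mem hg))
  refine ⟨Equiv.ofBijective σ (Finite.injective_iff_bijective.1 hσ), fun q => ?_⟩
  have hq : (⟦g' q.out⟧ : Quotient S) = ⟦(σ q).out⟧ := by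
    conv_rhs => rw [Quotient.out_eq, ← Quotient.out_eq q]
    rfl
  exact Quotient.exact hq 1 H.one_mem

end InvariantMeasure

theorem exists_forall_dist_iterate_lt_of_isometry {X : Type*} [PseudoMetricSpace X] [CompactSpace X]
    [IsUltrametricDist X] {f : X → X} (hf : Isometry f) {ε : ℝ} (hε : 0 < ε) :
    ∃ N ≥ 1, ∀ m x, dist (f^[N * m] x) x < ε := by
  -- `f` permutes the finitely many `ε`-balls.
  let S : Setoid X :=
    { r := fun x y => dist x y < ε
      iseqv :=
        { refl := fun x => by rwa [dist_self]
          symm := fun h => by rwa [dist_comm]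
          trans := fun h h' => (dist_triangle_max _ _ _).trans_lt (max_lt h h') } }
  have : Finite (Quotient S) := finite_quotient_of_forall_dist_lt hε fun _ _ h => h
  let σ : Quotient S → Quotient S := Quotient.map f fun x y hxy => by
    change dist (f x) (f y) < ε
    rwa [hf.dist_eq]
  have hσ : Function.Injective σ := Quotient.ind₂ fun x y hxy => Quotient.sound <| by
    have := Quotient.exact hxy
    change dist (f x) (f y) < ε at this
    rwa [hf.dist_eq] at this
  let τ : Equiv.Perm (Quotient S) := Equiv.ofBijective σ (Finite.injective_iff_bijective.1 hσ)
  refine ⟨orderOf τ, orderOf_pos τ, fun m x => Quotient.exact (?_ : (⟦_⟧ : Quotient S) = ⟦x⟧)⟩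
  have hsemi : Function.Semiconj (Quotient.mk S) f τ := fun _ => rfl
  rw [(hsemi.iterate_right _).eq, Equiv.Perm.iterate_eq_pow, pow_mul, pow_orderOf_eq_one, one_pow]
  rfl

section PingPong

variable {X : Type*} [TopologicalSpace X]

theorem isPingPongPair_conj {f l : X ≃ₜ X} {U V : Set X} (hU : IsOpen U) (hV : IsOpen V)
    (hUV : Disjoint U V) (hl : Disjoint (U ∪ V) (l '' (U ∪ V))) (hf : f '' Uᶜ ⊆ V) :
    IsPingPongPair f (l * f * l⁻¹) := by
  rw [Set.image_union, Set.disjoint_union_left, Set.disjoint_union_right,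
    Set.disjoint_union_right] at hl
  obtain ⟨⟨hUU, hUV'⟩, hVU, hVV⟩ := hl
  refine ⟨U, l '' U, V, l '' V, ⟨hU, l.isOpen_image.2 hU, hV, l.isOpen_image.2 hV⟩, ?_, hf, ?_⟩
  · simpa using ⟨⟨hUU, hUV, hUV'⟩, ⟨hVU.symm, (Set.disjoint_image_iff l.injective).2 hUV⟩, hVV⟩
  · rintro _ ⟨x, hx, rfl⟩
    obtain ⟨y, rfl⟩ := l.surjective x
    exact ⟨f y, hf ⟨y, fun hy => hx ⟨y, hy, rfl⟩, rfl⟩, by simp⟩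

theorem exists_isPingPongPair_of_image_compl_subset [T2Space X] {H : Subgroup (X ≃ₜ X)}
    (hH : ∀ x : X, (MulAction.orbit H x).Infinite) {R Φ : Set X} (hR : R.Finite) (hΦ : Φ.Finite)
    (h : ∀ U V : Set X, IsOpen U → IsOpen V → R ⊆ U → Φ ⊆ V → ∃ g ∈ H, g '' Uᶜ ⊆ V) :
    ∃ g ∈ H, ∃ h ∈ H, IsPingPongPair g h := by
  -- `k` moves the attracting set `Φ` off `R`, and `l` moves `R ∪ k Φ` off itself.
  obtain ⟨⟨k, hk⟩, hkR⟩ := exists_forall_smul_ne_of_infinite_orbit hΦ hR fun x _ => hH x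
  have hP : (R ∪ k '' Φ).Finite := hR.union (hΦ.image k)
  obtain ⟨⟨l, hl⟩, hlP⟩ := exists_forall_smul_ne_of_infinite_orbit hP hP fun x _ => hH x
  have hRΦ : Disjoint R (k '' Φ) := by
    rw [Set.disjoint_right]
    rintro _ ⟨φ, hφ, rfl⟩ hφR
    exact hkR φ hφ _ hφR rfl
  have hPP : Disjoint (R ∪ k '' Φ) (l '' (R ∪ k '' Φ)) := by
    rw [Set.disjoint_right]
    rintro _ ⟨x, hx, rfl⟩ hxP
    exact hlP x hx _ hxP rfl
  obtain ⟨U, V, hU, hV, hRU, hΦV, hUV⟩ := SeparatedNhds.of_finite hR (hΦ.image k) hRΦ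
  obtain ⟨W, W', hW, hW', hPW, hPW', hWW'⟩ := SeparatedNhds.of_finite hP (hP.image l) hPP
  have hQ : IsOpen (W ∩ l ⁻¹' W') := hW.inter (hW'.preimage l.continuous)
  have hPQ : R ∪ k '' Φ ⊆ W ∩ l ⁻¹' W' :=
    Set.subset_inter hPW (Set.image_subset_iff.1 hPW')
  obtain ⟨g, hg, hgU⟩ := h (U ∩ (W ∩ l ⁻¹' W')) (k ⁻¹' (V ∩ (W ∩ l ⁻¹' W'))) (hU.inter hQ)
    ((hV.inter hQ).preimage k.continuous)
    (Set.subset_inter hRU (Set.subset_union_left.trans hPQ))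
    (Set.image_subset_iff.1 (Set.subset_inter hΦV (Set.subset_union_right.trans hPQ)))
  have hkg := H.mul_mem hk hg
  refine ⟨k * g, hkg, l * (k * g) * l⁻¹, H.mul_mem (H.mul_mem hl hkg) (H.inv_mem hl),
    isPingPongPair_conj (hU.inter hQ) (hV.inter hQ)
      (hUV.mono Set.inter_subset_left Set.inter_subset_left) ?_ ?_⟩
  · have hsub : (U ∩ (W ∩ l ⁻¹' W')) ∪ (V ∩ (W ∩ l ⁻¹' W')) ⊆ W ∩ l ⁻¹' W' :=
      Set.union_subset Set.inter_subset_right Set.inter_subset_right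
    exact hWW'.mono (hsub.trans Set.inter_subset_left)
      (Set.image_subset_iff.2 (hsub.trans Set.inter_subset_right))
  · rintro _ ⟨x, hx, rfl⟩
    exact hgU ⟨x, hx, rfl⟩

end PingPong

theorem exists_pos_forall_eq_of_dist_lt_of_finite {X : Type*} [MetricSpace X] {s : Set X}
    (hs : s.Finite) : ∃ η > 0, ∀ u ∈ s, ∀ v ∈ s, dist u v < η → u = v := by
  by_cases hn : s.Nontrivial
  · refine ⟨_, hs.infsep_pos_iff_nontrivial.2 hn, fun u hu v hv huv => ?_⟩
    by_contra hne
    exact huv.not_ge (Set.infsep_le_dist_of_mem hu hv hne)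
  · exact ⟨1, one_pos, fun u hu v hv _ => Set.not_nontrivial_iff.1 hn hu hv⟩

theorem exists_le_forall_dist_lt_of_uniformContinuous {X Y : Type*} [PseudoMetricSpace X]
    [PseudoMetricSpace Y] {f : X → Y} (hf : UniformContinuous f) {ε : ℝ} (hε : 0 < ε) :
    ∃ η > 0, η ≤ ε ∧ ∀ x y, dist x y < η → dist (f x) (f y) < ε := by
  obtain ⟨η, hη, h⟩ := Metric.uniformContinuous_iff.1 hf ε hε
  exact ⟨min η ε, lt_min hη hε, min_le_right _ _,
    fun x y hxy => h (hxy.trans_le (min_le_left _ _))⟩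

section Collapse

variable {X : Type*} [MetricSpace X]

/-- Up to `ε`, the map `h` is the identity on `K` and sends the rest of the space into `Φ`, with the
possible exception of points that are `ε`-close to `R` but do not belong to `R`. -/
def IsCollapsing (R Φ K : Set X) (ε : ℝ) (h : X → X) : Prop :=
  (∀ x ∉ K, (∀ r ∈ R, dist x r < ε → x = r) → ∃ φ ∈ Φ, dist (h x) φ < ε) ∧
    ∀ x ∈ K, dist (h x) x < ε

/-- For suitable finite sets `R` (repelling) and `Φ` (attracting), the set `A` contains
homeomorphisms that collapse the complement of `K` to `Φ` away from `R`, and fix `K`, up to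
arbitrarily small errors. -/
def Collapses (A : Set (X ≃ₜ X)) (K : Set X) : Prop :=
  ∃ R Φ : Set X, R.Finite ∧ Φ.Finite ∧ ∀ ε > 0, ∃ h ∈ A, IsCollapsing R Φ K ε h

/-- The powers of `g` with positive exponent. -/
def positivePowers (g : X ≃ₜ X) : Set (X ≃ₜ X) := {h | ∃ n ≥ 1, h = g ^ n}

theorem IsCollapsing.mono {R Φ K : Set X} {ε ε' : ℝ} {h : X → X} (hh : IsCollapsing R Φ K ε h)
    (hε : ε ≤ ε') : IsCollapsing R Φ K ε' h := by
  refine ⟨fun x hx hr => ?_, fun x hx => (hh.2 x hx).trans_le hε⟩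
  obtain ⟨φ, hφ, h'⟩ := hh.1 x hx fun r hr' hxr => hr r hr' (hxr.trans_le hε)
  exact ⟨φ, hφ, h'.trans_le hε⟩

theorem IsCollapsing.comp [IsUltrametricDist X] {R₁ R₂ Φ₁ Φ₂ K₁ K₂ : Set X} {η ε : ℝ}
    {g₁ g₂ : X → X} (h₁ : IsCollapsing R₁ Φ₁ K₁ η g₁) (h₂ : IsCollapsing R₂ Φ₂ K₂ ε g₂)
    (hηε : η ≤ ε) (hg₂ : ∀ x y, dist x y < η → dist (g₂ x) (g₂ y) < ε)
    (hsep : ∀ φ ∈ Φ₁, ∀ r ∈ R₂, dist φ r < ε → φ = r) :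
    IsCollapsing (R₁ ∪ R₂) (Φ₁ ∪ Φ₂) (K₁ ∩ K₂) ε (g₂ ∘ g₁) := by
  have htri : ∀ {a b c : X}, dist a b < ε → dist b c < ε → dist a c < ε := fun h h' =>
    (dist_triangle_max _ _ _).trans_lt (max_lt h h')
  refine ⟨fun x hx hr => ?_, fun x hx => htri (hg₂ _ _ (h₁.2 x hx.1)) (h₂.2 x hx.2)⟩
  by_cases hx₁ : x ∈ K₁
  · obtain ⟨φ, hφ, h⟩ := h₂.1 x (fun hx₂ => hx ⟨hx₁, hx₂⟩) fun r hr' => hr r (Or.inr hr')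
    exact ⟨φ, Or.inr hφ, htri (hg₂ _ _ (h₁.2 x hx₁)) h⟩
  obtain ⟨φ, hφ, hxφ⟩ := h₁.1 x hx₁ fun r hr' hxr => hr r (Or.inl hr') (hxr.trans_le hηε)
  by_cases hφ₂ : φ ∈ K₂
  · exact ⟨φ, Or.inl hφ, htri (hg₂ _ _ hxφ) (h₂.2 φ hφ₂)⟩
  · obtain ⟨ψ, hψ, hφψ⟩ := h₂.1 φ hφ₂ (hsep φ hφ)
    exact ⟨ψ, Or.inr hψ, htri (hg₂ _ _ hxφ) hφψ⟩

theorem Collapses.mono {A B : Set (X ≃ₜ X)} {K : Set X} (h : Collapses A K) (hAB : A ⊆ B) :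
    Collapses B K := by
  obtain ⟨R, Φ, hR, hΦ, h⟩ := h
  refine ⟨R, Φ, hR, hΦ, fun ε hε => ?_⟩
  obtain ⟨k, hk, hc⟩ := h ε hε
  exact ⟨k, hAB hk, hc⟩

theorem collapses_univ (H : Subgroup (X ≃ₜ X)) : Collapses (H : Set (X ≃ₜ X)) Set.univ :=
  ⟨∅, ∅, Set.finite_empty, Set.finite_empty, fun ε hε => ⟨1, H.one_mem,
    fun x hx => absurd (Set.mem_univ x) hx, fun x _ => by simpa using hε⟩⟩

theorem Collapses.exists_image_compl_subset {A : Set (X ≃ₜ X)} (h : Collapses A ∅) :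
    ∃ R Φ : Set X, R.Finite ∧ Φ.Finite ∧ ∀ U V : Set X, IsOpen U → IsOpen V → R ⊆ U → Φ ⊆ V →
      ∃ g ∈ A, g '' Uᶜ ⊆ V := by
  obtain ⟨R, Φ, hR, hΦ, h⟩ := h
  refine ⟨R, Φ, hR, hΦ, fun U V hU hV hRU hΦV => ?_⟩
  obtain ⟨δ, hδ, hRδ⟩ := hR.isCompact.exists_thickening_subset_open hU hRU
  obtain ⟨η, hη, hΦη⟩ := hΦ.isCompact.exists_thickening_subset_open hV hΦV
  obtain ⟨g, hg, hc⟩ := h (min δ η) (lt_min hδ hη)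
  refine ⟨g, hg, ?_⟩
  rintro _ ⟨x, hx, rfl⟩
  obtain ⟨φ, hφ, hxφ⟩ := hc.1 x (Set.notMem_empty x) fun r hr hxr =>
    absurd (hRδ (Metric.mem_thickening_iff.2 ⟨r, hr, hxr.trans_le (min_le_left _ _)⟩)) hx
  exact hΦη (Metric.mem_thickening_iff.2 ⟨φ, hφ, hxφ.trans_le (min_le_right _ _)⟩)

variable [CompactSpace X]

theorem Collapses.inter [IsUltrametricDist X] {H : Subgroup (X ≃ₜ X)} {K₁ K₂ : Set X}
    (h₁ : Collapses (H : Set (X ≃ₜ X)) K₁) (h₂ : Collapses (H : Set (X ≃ₜ X)) K₂) :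
    Collapses (H : Set (X ≃ₜ X)) (K₁ ∩ K₂) := by
  obtain ⟨R₁, Φ₁, hR₁, hΦ₁, h₁⟩ := h₁
  obtain ⟨R₂, Φ₂, hR₂, hΦ₂, h₂⟩ := h₂
  obtain ⟨δ, hδ, hsep⟩ := exists_pos_forall_eq_of_dist_lt_of_finite (hΦ₁.union hR₂)
  refine ⟨R₁ ∪ R₂, Φ₁ ∪ Φ₂, hR₁.union hR₂, hΦ₁.union hΦ₂, fun ε hε => ?_⟩
  obtain ⟨g₂, hg₂, hc₂⟩ := h₂ (min ε δ) (lt_min hε hδ)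
  obtain ⟨η, hη, hηε, hg₂η⟩ := exists_le_forall_dist_lt_of_uniformContinuous
    (CompactSpace.uniformContinuous_of_continuous g₂.continuous) (lt_min hε hδ)
  obtain ⟨g₁, hg₁, hc₁⟩ := h₁ η hη
  exact ⟨g₂ * g₁, H.mul_mem hg₂ hg₁, (hc₁.comp hc₂ hηε hg₂η fun φ hφ r hr hφr =>
    hsep φ (Or.inl hφ) r (Or.inr hr) (hφr.trans_le (min_le_right _ _))).mono (min_le_left _ _)⟩

theorem collapses_sInter [IsUltrametricDist X] {H : Subgroup (X ≃ₜ X)} {F : Set (Set X)}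
    (hF : F.Finite) (h : ∀ K ∈ F, Collapses (H : Set (X ≃ₜ X)) K) :
    Collapses (H : Set (X ≃ₜ X)) (⋂₀ F) := by
  induction F, hF using Set.Finite.induction_on with
  | empty => simpa using collapses_univ H
  | @insert K F _ _ ih =>
    rw [Set.sInter_insert]
    exact (h K (Or.inl rfl)).inter (ih fun L hL => h L (Or.inr hL))

theorem Collapses.conj {g : X ≃ₜ X} {K : Set X} (h : Collapses (positivePowers g) K)
    (k : X ≃ₜ X) : Collapses (positivePowers (k * g * k⁻¹)) (k '' K) := by
  obtain ⟨R, Φ, hR, hΦ, h⟩ := h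
  refine ⟨k '' R, k '' Φ, hR.image k, hΦ.image k, fun ε hε => ?_⟩
  obtain ⟨η, hη, -, hk⟩ := exists_le_forall_dist_lt_of_uniformContinuous
    (CompactSpace.uniformContinuous_of_continuous k.continuous) hε
  obtain ⟨_, ⟨n, hn, rfl⟩, hc⟩ := h η hη
  refine ⟨_, ⟨n, hn, rfl⟩, fun x hx hr => ?_, ?_⟩
  · obtain ⟨y, rfl⟩ := k.surjective x
    obtain ⟨φ, hφ, h'⟩ := hc.1 y (fun hy => hx ⟨y, hy, rfl⟩) fun r hr' hyr =>
      k.injective (hr _ ⟨r, hr', rfl⟩ (hk _ _ hyr))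
    refine ⟨k φ, ⟨φ, hφ, rfl⟩, ?_⟩
    rw [conj_pow]
    simpa using hk _ _ h'
  · rintro _ ⟨y, hy, rfl⟩
    rw [conj_pow]
    simpa using hk _ _ (hc.2 y hy)

end Collapse

section ScalesDistOn

variable {X Y Z : Type*} [MetricSpace X] [MetricSpace Y] [MetricSpace Z]

/-- On the set `s`, the map `g` multiplies distances by the positive constant `c`. -/
def ScalesDistOn (g : X → Y) (s : Set X) (c : ℝ) : Prop :=
  0 < c ∧ ∀ u ∈ s, ∀ v ∈ s, dist (g u) (g v) = c * dist u v

/-- Every point has a neighbourhood on which `g` multiplies distances by a constant. -/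
def IsLocalHomothety (g : X → Y) : Prop :=
  ∀ x, ∃ r > 0, ∃ c, ScalesDistOn g (Metric.ball x r) c

theorem scalesDistOn_id (s : Set X) : ScalesDistOn (id : X → X) s 1 :=
  ⟨one_pos, fun _ _ _ _ => (one_mul _).symm⟩

theorem ScalesDistOn.mono {g : X → Y} {s t : Set X} {c : ℝ} (h : ScalesDistOn g t c)
    (hst : s ⊆ t) : ScalesDistOn g s c :=
  ⟨h.1, fun u hu v hv => h.2 u (hst hu) v (hst hv)⟩

theorem ScalesDistOn.comp {g : X → Y} {h : Y → Z} {s : Set X} {t : Set Y} {c d : ℝ}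
    (hh : ScalesDistOn h t d) (hg : ScalesDistOn g s c) (hst : Set.MapsTo g s t) :
    ScalesDistOn (h ∘ g) s (d * c) := by
  refine ⟨mul_pos hh.1 hg.1, fun u hu v hv => ?_⟩
  rw [Function.comp_apply, Function.comp_apply, hh.2 _ (hst hu) _ (hst hv), hg.2 u hu v hv,
    mul_assoc]

theorem ScalesDistOn.iterate {g : X → X} {s : Set X} {c : ℝ} (h : ScalesDistOn g s c)
    (hs : Set.MapsTo g s s) (n : ℕ) : ScalesDistOn g^[n] s (c ^ n) := by
  induction n with
  | zero => simpa using scalesDistOn_id s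
  | succ n ih => exact pow_succ c n ▸ ih.comp h hs

theorem ScalesDistOn.mapsTo_ball {g : X → Y} {x : X} {r c : ℝ}
    (h : ScalesDistOn g (Metric.ball x r) c) :
    Set.MapsTo g (Metric.ball x r) (Metric.ball (g x) (c * r)) := by
  intro u hu
  rw [Metric.mem_ball, h.2 u hu x (Metric.mem_ball_self (Metric.pos_of_mem_ball hu))]
  exact mul_lt_mul_of_pos_left hu h.1

theorem ScalesDistOn.mul_eq_one {g : X → Y} {h : Y → X} {s : Set X} {t : Set Y} {c d : ℝ}
    (hh : ScalesDistOn h t d) (hg : ScalesDistOn g s c) (hgh : Function.LeftInverse h g) {x y : X}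
    (hxs : x ∈ s) (hys : y ∈ s) (hxt : g x ∈ t) (hyt : g y ∈ t) (hxy : x ≠ y) : d * c = 1 := by
  have hdist := hh.2 _ hxt _ hyt
  rw [hgh, hgh, hg.2 x hxs y hys, ← mul_assoc] at hdist
  exact (eq_div_of_mul_eq (dist_ne_zero.2 hxy) hdist.symm).trans (div_self (dist_ne_zero.2 hxy))

variable [CompactSpace X]

theorem IsLocalHomothety.eventually_scalesDistOn_ball {g : X → Y} (hg : IsLocalHomothety g) :
    ∀ᶠ δ in 𝓝[>] (0 : ℝ), ∀ x, ∃ c, ScalesDistOn g (Metric.ball x δ) c := by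
  choose r hr c hc using hg
  obtain ⟨δ, hδ, h⟩ := lebesgue_number_lemma_of_metric (s := (Set.univ : Set X))
    (c := fun x => Metric.ball x (r x)) isCompact_univ (fun x => Metric.isOpen_ball)
    (fun x _ => Set.mem_iUnion.2 ⟨x, Metric.mem_ball_self (hr x)⟩)
  filter_upwards [Ioo_mem_nhdsGT hδ] with η hη x
  obtain ⟨y, hy⟩ := h x (Set.mem_univ x)
  exact ⟨c y, (hc y).mono ((Metric.ball_subset_ball hη.2.le).trans hy)⟩

theorem exists_uniform_scalesDistOn_ball {A : Set (X ≃ₜ X)} (hA : A.Finite)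
    (h : ∀ g ∈ A, IsLocalHomothety g) :
    ∃ δ > 0, ∀ g ∈ A, ∀ x, ∃ c, ScalesDistOn g (Metric.ball x δ) c :=
  (Filter.Eventually.and (eventually_mem_nhdsWithin (s := Set.Ioi 0))
    ((Filter.eventually_all_finite hA).2 fun g hg => (h g hg).eventually_scalesDistOn_ball)).exists

end ScalesDistOn

section MinimalSet

variable {X : Type*} [TopologicalSpace X]

/-- `A` is a nonempty closed set preserved by `H`. -/
structure IsClosedInvariant (H : Subgroup (X ≃ₜ X)) (A : Set X) : Prop where
  isClosed : IsClosed A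
  nonempty : A.Nonempty
  mapsTo : ∀ g ∈ H, Set.MapsTo g A A

/-- `M` is minimal among the nonempty closed sets preserved by `H`. -/
def IsMinimalSet (H : Subgroup (X ≃ₜ X)) (M : Set X) : Prop := Minimal (IsClosedInvariant H) M

variable {H : Subgroup (X ≃ₜ X)}

theorem IsClosedInvariant.exists_isMinimalSet_subset [CompactSpace X] {N : Set X}
    (hN : IsClosedInvariant H N) : ∃ M ⊆ N, IsMinimalSet H M := by
  refine zorn_superset_nonempty {A | IsClosedInvariant H A} (fun c hc hchain hne => ?_) N hN
  have : Nonempty c := hne.to_subtype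
  refine ⟨⋂₀ c, ⟨isClosed_sInter fun A hA => (hc hA).isClosed, ?_, fun g hg x hx A hA =>
    (hc hA).mapsTo g hg (hx A hA)⟩, fun A hA => Set.sInter_subset_of_mem hA⟩
  rw [Set.sInter_eq_iInter]
  exact IsCompact.nonempty_iInter_of_directed_nonempty_isCompact_isClosed _
    (fun A B => (hchain.total A.2 B.2).elim (⟨A, subset_rfl, ·⟩) (⟨B, ·, subset_rfl⟩))
    (fun A => (hc A.2).nonempty) (fun A => (hc A.2).isClosed.isCompact) (fun A => (hc A.2).isClosed)

theorem IsMinimalSet.exists_apply_mem {M : Set X} (hM : IsMinimalSet H M) {x y : X} (hx : x ∈ M)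
    (hy : y ∈ M) {U : Set X} (hU : U ∈ 𝓝 y) : ∃ g ∈ H, g x ∈ U := by
  have horbit : IsClosedInvariant H (closure (MulAction.orbit H x)) := by
    refine ⟨isClosed_closure, (MulAction.nonempty_orbit x).closure, fun g hg => ?_⟩
    refine Set.MapsTo.closure ?_ g.continuous
    exact fun z hz => MulAction.mem_orbit_of_mem_orbit (⟨g, hg⟩ : H) hz
  have hsub : closure (MulAction.orbit H x) ⊆ M := by
    refine closure_minimal ?_ hM.prop.isClosed
    rintro _ ⟨g, rfl⟩
    exact hM.prop.mapsTo g g.2 hx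
  obtain ⟨_, hgU, g, rfl⟩ := mem_closure_iff_nhds.1 (hM.le_of_le horbit hsub hy) U hU
  exact ⟨g, g.2, hgU⟩

theorem IsMinimalSet.subset_derivedSet [T1Space X] [CompactSpace X] {M : Set X}
    (hM : IsMinimalSet H M) (hH : ∀ x : X, (MulAction.orbit H x).Infinite) :
    M ⊆ derivedSet M := by
  have hder : IsClosedInvariant H (derivedSet M) := by
    refine ⟨isClosed_derivedSet M, ?_, fun g hg x hx => ?_⟩
    · obtain ⟨x, hx⟩ := hM.prop.nonempty
      have hxM : MulAction.orbit H x ⊆ M := by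
        rintro _ ⟨g, rfl⟩
        exact hM.prop.mapsTo g g.2 hx
      obtain ⟨z, -, hz⟩ := (hH x).exists_accPt_of_subset_isCompact
        hM.prop.isClosed.isCompact hxM
      exact ⟨z, hz.mono (Filter.principal_mono.2 hxM)⟩
    · exact derivedSet_mono _ _ (hM.prop.mapsTo g hg).image_subset
        (g.continuous.image_derivedSet g.injective ⟨x, hx, rfl⟩)
  exact hM.le_of_le hder ((isClosed_iff_derivedSet_subset M).1 hM.prop.isClosed)

end MinimalSet

section Contraction

variable {X : Type*} [MetricSpace X] {H : Subgroup (X ≃ₜ X)} {M : Set X}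

theorem exists_scalesDistOn_ball_div {S : Set (X ≃ₜ X)} {δ c₀ : ℝ}
    (hM : ∀ g ∈ Subgroup.closure S, Set.MapsTo g M M)
    (hS : ∀ s ∈ S ∪ S⁻¹, ∀ x, ∃ c, ScalesDistOn s (Metric.ball x δ) c) (hδ : 0 < δ) (hc₀ : 0 < c₀)
    (h : ∀ g ∈ Subgroup.closure S, ∀ y ∈ M, ∀ c, ScalesDistOn g (Metric.ball y δ) c → c₀ ≤ c)
    {g : X ≃ₜ X} (hg : g ∈ Subgroup.closure S) :
    ∀ x ∈ M, ∃ c ≥ c₀, ScalesDistOn g (Metric.ball x (c₀ * δ / c)) c := by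
  -- Scaling factors multiply along a word in the generators, so `g * s` has the factor `c * d` on
  -- any ball of radius at most `δ` which `s` maps into the ball provided for `g`.
  have hstep : ∀ g ∈ Subgroup.closure S, ∀ s ∈ S ∪ S⁻¹, s ∈ Subgroup.closure S →
      (∀ x ∈ M, ∃ c ≥ c₀, ScalesDistOn g (Metric.ball x (c₀ * δ / c)) c) →
      ∀ x ∈ M, ∃ c ≥ c₀, ScalesDistOn (g * s) (Metric.ball x (c₀ * δ / c)) c := by
    intro g hg s hs hs' ih x hx
    obtain ⟨c, hc, hgc⟩ := ih (s x) (hM s hs' hx)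
    obtain ⟨d, hd⟩ := hS s hs x
    have hc' : 0 < c := hc₀.trans_le hc
    have hscale : ∀ r ≤ δ, c * d * r ≤ c₀ * δ → ScalesDistOn (g * s) (Metric.ball x r) (c * d) := by
      intro r hr hcdr
      have hdr := hd.mono (Metric.ball_subset_ball hr)
      refine hgc.comp hdr (hdr.mapsTo_ball.mono_right (Metric.ball_subset_ball ?_))
      rw [le_div_iff₀ hc']
      linarith
    have hcd : c₀ ≤ c * d := by
      by_contra! hlt
      exact hlt.not_ge (h _ (mul_mem hg hs') x hx _ (hscale δ le_rfl (by gcongr)))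
    have hcd' : 0 < c * d := hc₀.trans_le hcd
    refine ⟨c * d, hcd, hscale _ ((div_le_iff₀ hcd').2 ?_) (mul_div_cancel₀ _ hcd'.ne').le⟩
    rw [mul_comm]
    gcongr
  induction hg using Subgroup.closure_induction_right with
  | one =>
    intro x hx
    have hone : c₀ ≤ 1 := h 1 (one_mem _) x hx 1 (scalesDistOn_id _)
    exact ⟨1, hone, scalesDistOn_id _⟩
  | mul_right g hg s hs ih =>
    exact hstep g hg s (Or.inl hs) (Subgroup.subset_closure hs) ih
  | mul_inv_cancel g hg s hs ih =>
    exact hstep g hg s⁻¹ (Or.inr (Set.inv_mem_inv.2 hs))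
      (inv_mem (Subgroup.subset_closure hs)) ih

variable [CompactSpace X]

theorem IsMinimalSet.exists_ne_mem_ball (hM : IsMinimalSet H M)
    (hH : ∀ x : X, (MulAction.orbit H x).Infinite) {x : X} (hx : x ∈ M) {ε : ℝ} (hε : 0 < ε) :
    ∃ y ∈ M, y ∈ Metric.ball x ε ∧ y ≠ x := by
  obtain ⟨y, ⟨hyx, hyM⟩, hne⟩ := accPt_iff_nhds.1 (hM.subset_derivedSet hH hx) _
    (Metric.ball_mem_nhds x hε)
  exact ⟨y, hyM, hyx, hne⟩

theorem IsMinimalSet.mul_eq_one_of_scalesDistOn_symm (hM : IsMinimalSet H M)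
    (hH : ∀ x : X, (MulAction.orbit H x).Infinite) {x : X} (hx : x ∈ M) {g : X ≃ₜ X}
    {r r' c d : ℝ} (hr : 0 < r) (hr' : 0 < r') (hg : ScalesDistOn g (Metric.ball x r) c)
    (hg' : ScalesDistOn g.symm (Metric.ball (g x) r') d) : d * c = 1 := by
  obtain ⟨η, hη, hgη⟩ := Metric.continuousAt_iff.1 g.continuous.continuousAt r' hr'
  obtain ⟨z, -, hzx, hne⟩ := hM.exists_ne_mem_ball hH hx (lt_min hr hη)
  exact hg'.mul_eq_one hg g.symm_apply_apply (Metric.mem_ball_self hr)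
    (Metric.ball_subset_ball (min_le_left _ _) hzx) (Metric.mem_ball_self hr')
    (hgη (hzx.trans_le (min_le_right _ _))) hne.symm

variable [IsUltrametricDist X]

theorem IsMinimalSet.exists_uniform_return (hM : IsMinimalSet H M)
    (hloc : ∀ g ∈ H, IsLocalHomothety g) {δ : ℝ} (hδ : 0 < δ) :
    ∃ ρ > 0, ∀ z ∈ M, ∀ y ∈ M, ∃ k ∈ H, (∃ c ≤ ρ⁻¹, ScalesDistOn k (Metric.ball z ρ) c) ∧
      Set.MapsTo k (Metric.ball z ρ) (Metric.ball y δ) := by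
  suffices h : ∀ᶠ ρ in 𝓝 (0 : ℝ), ∀ p ∈ M ×ˢ M, 0 < ρ → ∃ k ∈ H,
      (∃ c ≤ ρ⁻¹, ScalesDistOn k (Metric.ball p.1 ρ) c) ∧
        Set.MapsTo k (Metric.ball p.1 ρ) (Metric.ball p.2 δ) by
    obtain ⟨ρ, hρ, h⟩ := (Filter.Eventually.and (eventually_mem_nhdsWithin (s := Set.Ioi 0))
      (nhdsWithin_le_nhds h)).exists
    exact ⟨ρ, hρ, fun z hz y hy => h (z, y) ⟨hz, hy⟩ hρ⟩
  refine (hM.prop.isClosed.isCompact.prod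
    hM.prop.isClosed.isCompact).eventually_forall_of_forall_eventually ?_
  rintro ⟨z, y⟩ ⟨hz, hy⟩
  obtain ⟨k, hk, hky⟩ := hM.exists_apply_mem hz hy (Metric.ball_mem_nhds y hδ)
  obtain ⟨r, hr, c, hc⟩ := hloc k hk z
  obtain ⟨r', hr', hkr'⟩ := Metric.mem_nhds_iff.1
    (k.continuous.continuousAt.preimage_mem_nhds (Metric.isOpen_ball.mem_nhds hky))
  have hmin : 0 < min (min r r') c⁻¹ := lt_min (lt_min hr hr') (inv_pos.2 hc.1)
  rw [nhds_prod_eq, nhds_prod_eq]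
  filter_upwards [Filter.prod_mem_prod (gt_mem_nhds hmin)
    (Filter.prod_mem_prod (Metric.ball_mem_nhds z (lt_min hr hr')) (Metric.ball_mem_nhds y hδ))]
  rintro ⟨ρ, z', y'⟩ ⟨hρ, hz', hy'⟩ hρ0
  have hball : Metric.ball z' ρ ⊆ Metric.ball z (min r r') := by
    rw [IsUltrametricDist.ball_eq_of_mem hz']
    exact Metric.ball_subset_ball (hρ.trans_le (min_le_left _ _)).le
  refine ⟨k, hk, ⟨c, ?_, hc.mono (hball.trans (Metric.ball_subset_ball (min_le_left _ _)))⟩, ?_⟩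
  · exact (le_inv_comm₀ hρ0 hc.1).1 (hρ.trans_le (min_le_right _ _)).le
  · rw [← IsUltrametricDist.ball_eq_of_mem hy']
    exact fun u hu => hkr' (Metric.ball_subset_ball (min_le_right _ _) (hball hu))

theorem IsMinimalSet.exists_contracting (hM : IsMinimalSet H M)
    (hH : ∀ x : X, (MulAction.orbit H x).Infinite) (hloc : ∀ g ∈ H, IsLocalHomothety g)
    {δ : ℝ} (hδ : 0 < δ)
    (h : ∀ c₀ > 0, ∃ g ∈ H, ∃ y ∈ M, ∃ c < c₀, ScalesDistOn g (Metric.ball y δ) c) :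
    ∃ g ∈ H, ∃ y ∈ M, ∃ y' ∈ M, ∀ n ≥ 1, dist (g^[n] y) (g^[n] y') < dist y y' := by
  obtain ⟨ρ, hρ, hreturn⟩ := hM.exists_uniform_return hloc hδ
  obtain ⟨g, hg, y, hy, c, hc, hgc⟩ := h (min (ρ / δ) ρ) (lt_min (div_pos hρ hδ) hρ)
  obtain ⟨k, hk, ⟨d, hd, hkd⟩, hky⟩ := hreturn (g y) (hM.prop.mapsTo g hg hy) y hy
  have hgρ : Set.MapsTo g (Metric.ball y δ) (Metric.ball (g y) ρ) :=
    hgc.mapsTo_ball.mono_right (Metric.ball_subset_ball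
      ((lt_div_iff₀ hδ).1 (hc.trans_le (min_le_left _ _))).le)
  have hcd : d * c < 1 := by
    calc d * c ≤ ρ⁻¹ * c := mul_le_mul_of_nonneg_right hd hgc.1.le
      _ < ρ⁻¹ * ρ := mul_lt_mul_of_pos_left (hc.trans_le (min_le_right _ _)) (inv_pos.2 hρ)
      _ = 1 := inv_mul_cancel₀ hρ.ne'
  have hkg : ScalesDistOn (k * g) (Metric.ball y δ) (d * c) := hkd.comp hgc hgρ
  have hmaps : Set.MapsTo (k * g) (Metric.ball y δ) (Metric.ball y δ) := hky.comp hgρ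
  obtain ⟨y', hy', hyy', hne⟩ := hM.exists_ne_mem_ball hH hy hδ
  refine ⟨k * g, H.mul_mem hk hg, y, hy, y', hy', fun n hn => ?_⟩
  rw [(hkg.iterate hmaps n).2 y (Metric.mem_ball_self hδ) y' hyy']
  exact mul_lt_of_lt_one_left (dist_pos.2 hne.symm)
    (pow_lt_one₀ hkg.1.le hcd (Nat.one_le_iff_ne_zero.1 hn))

theorem IsMinimalSet.exists_contracting_of_not_preserves [MeasurableSpace X] [BorelSpace X]
    {S : Set (X ≃ₜ X)} (hS : S.Finite) (hloc : ∀ g ∈ Subgroup.closure S, IsLocalHomothety g)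
    (hM : IsMinimalSet (Subgroup.closure S) M)
    (hpres : ¬ PreservesRegularProbability (Subgroup.closure S)) :
    ∃ g ∈ Subgroup.closure S, ∃ y ∈ M, ∃ y' ∈ M,
      ∀ n ≥ 1, dist (g^[n] y) (g^[n] y') < dist y y' := by
  have hH := infinite_orbit_of_not_preservesRegularProbability hpres
  obtain ⟨δ, hδ, hSδ⟩ := exists_uniform_scalesDistOn_ball (hS.union hS.inv) fun s hs => hloc s <| by
    rcases hs with hs | hs
    · exact Subgroup.subset_closure hs
    · exact inv_mem_iff.1 (Subgroup.subset_closure hs)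
  refine hM.exists_contracting hH hloc hδ ?_
  by_contra! hbelow
  obtain ⟨c₀, hc₀, hbelow⟩ := hbelow
  have hscale := fun g (hg : g ∈ Subgroup.closure S) =>
    exists_scalesDistOn_ball_div hM.prop.mapsTo hSδ hδ hc₀
      (fun g hg y hy c hc => not_lt.1 fun hlt => hbelow g hg y hy c hlt hc) hg
  refine hpres (preservesRegularProbability_of_equicontinuousOn hM.prop.isClosed hM.prop.nonempty
    hM.prop.mapsTo fun ε hε => ⟨min (c₀ * δ * c₀) (c₀ * ε), by positivity,
      fun g hg x hx y _ hxy => ?_⟩)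
  obtain ⟨c, hc, hgc⟩ := hscale g hg x hx
  obtain ⟨d, hd, hgd⟩ := hscale g⁻¹ (inv_mem hg) (g x) (hM.prop.mapsTo g hg hx)
  have hc' : 0 < c := hc₀.trans_le hc
  have hd' : 0 < d := hc₀.trans_le hd
  have hdc : d * c = 1 :=
    hM.mul_eq_one_of_scalesDistOn_symm hH hx (by positivity) (by positivity) hgc hgd
  have hcc₀ : c * c₀ ≤ 1 := by rw [← hdc, mul_comm]; gcongr
  have hyball : y ∈ Metric.ball x (c₀ * δ / c) := by
    rw [Metric.mem_ball', lt_div_iff₀ hc']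
    calc dist x y * c < c₀ * δ * c₀ * c := by gcongr; exact hxy.trans_le (min_le_left _ _)
      _ = c * c₀ * (c₀ * δ) := by ring
      _ ≤ c₀ * δ := mul_le_of_le_one_left (by positivity) hcc₀
  rw [hgc.2 x (Metric.mem_ball_self (by positivity)) y hyball]
  calc c * dist x y < c * (c₀ * ε) := by gcongr; exact hxy.trans_le (min_le_right _ _)
    _ = c * c₀ * ε := by ring
    _ ≤ ε := mul_le_of_le_one_left hε.le hcc₀

end Contraction

section StableSet

variable {X : Type*} [MetricSpace X] {g : X ≃ₜ X} {ρ : ℝ} {x y : X}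

/-- Around every point `x`, the map `g` scales distances on the ball of radius `ρ` together with the
preimage of the ball of radius `ρ` around `g x`, so that one constant serves both `g` and `g⁻¹`. -/
def IsGauge (g : X ≃ₜ X) (ρ : ℝ) : Prop :=
  ∀ x, ∃ c, ScalesDistOn g (Metric.ball x ρ ∪ g ⁻¹' Metric.ball (g x) ρ) c

/-- The points whose forward orbit stays `ρ`-close to the forward orbit of `x`. -/
def stableSet (g : X → X) (ρ : ℝ) (x : X) : Set X :=
  {y | ∀ k, dist (g^[k] y) (g^[k] x) < ρ}

theorem IsGauge.symm (h : IsGauge g ρ) : IsGauge g.symm ρ := by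
  intro x
  obtain ⟨c, hc, hg⟩ := h (g.symm x)
  refine ⟨c⁻¹, inv_pos.2 hc, fun u hu v hv => ?_⟩
  have huv := hg (g.symm u) (by simpa using hu.symm) (g.symm v) (by simpa using hv.symm)
  rw [g.apply_symm_apply, g.apply_symm_apply] at huv
  rw [huv, inv_mul_cancel_left₀ hc.ne']

theorem IsLocalHomothety.exists_isGauge [CompactSpace X] (hg : IsLocalHomothety g) :
    ∃ ρ > 0, IsGauge g ρ := by
  obtain ⟨δ, hδ, h⟩ := (Filter.Eventually.and (eventually_mem_nhdsWithin (s := Set.Ioi 0))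
    hg.eventually_scalesDistOn_ball).exists
  obtain ⟨ρ, hρ, hρδ, hsymm⟩ := exists_le_forall_dist_lt_of_uniformContinuous
    (CompactSpace.uniformContinuous_of_continuous g.symm.continuous) hδ
  refine ⟨ρ, hρ, fun x => (h x).imp fun c hc => hc.mono (Set.union_subset
    (Metric.ball_subset_ball hρδ) fun u hu => ?_)⟩
  simpa using hsymm _ _ hu

theorem stableSet_iterate (h : y ∈ stableSet g ρ x) (n : ℕ) :
    g^[n] y ∈ stableSet g ρ (g^[n] x) := fun k => by
  rw [← Function.iterate_add_apply, ← Function.iterate_add_apply]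
  exact h (k + n)

theorem IsGauge.exists_scalesDistOn_stableSet (h : IsGauge g ρ) (x : X) (k : ℕ) :
    ∃ c, ScalesDistOn g^[k] (stableSet g ρ x) c := by
  induction k with
  | zero => exact ⟨1, scalesDistOn_id _⟩
  | succ k ih =>
    obtain ⟨c, hc⟩ := ih
    obtain ⟨d, hd⟩ := h (g^[k] x)
    exact ⟨d * c, Function.iterate_succ' g k ▸ hd.comp hc fun u hu => Or.inl (hu k)⟩

/-- The time `k` is the first one at which the orbits of `x` and `y` are `ρ` apart; up to then the
scaling factors of `g` along the orbit of `x` compare the distances of `y` and `z` to it. -/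
theorem IsGauge.exists_exit (h : IsGauge g ρ) (hy : y ∉ stableSet g ρ x) :
    ∃ k, ρ ≤ dist (g^[k] y) (g^[k] x) ∧ ∀ z, dist (g^[k] z) (g^[k] x) < ρ →
      (∀ j ≤ k, dist (g^[j] z) (g^[j] x) < ρ) ∧ dist z x < dist y x := by
  classical
  have hex : ∃ k, ρ ≤ dist (g^[k] y) (g^[k] x) := by simpa [stableSet] using hy
  set k := Nat.find hex
  have hk : ρ ≤ dist (g^[k] y) (g^[k] x) := Nat.find_spec hex
  refine ⟨k, hk, fun z hz => ?_⟩
  have hρ : 0 < ρ := Metric.pos_of_mem_ball hz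
  suffices hcloser : ∀ j ≤ k, dist (g^[j] z) (g^[j] x) < ρ ∧
      dist (g^[j] z) (g^[j] x) < dist (g^[j] y) (g^[j] x) from
    ⟨fun j hj => (hcloser j hj).1, (hcloser 0 (Nat.zero_le k)).2⟩
  intro j hj
  induction hj using Nat.decreasingInduction with
  | self => exact ⟨hz, hz.trans_le hk⟩
  | of_succ j hj ih =>
    simp only [Function.iterate_succ_apply'] at ih
    obtain ⟨c, hc, hg⟩ := h (g^[j] x)
    have hyj : dist (g^[j] y) (g^[j] x) < ρ := not_le.1 (Nat.find_min hex hj)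
    have hxj := Metric.mem_ball_self (x := g^[j] x) hρ
    have hlt := ih.2
    rw [hg _ (Or.inr ih.1) _ (Or.inl hxj), hg _ (Or.inl hyj) _ (Or.inl hxj)] at hlt
    have hlt' := lt_of_mul_lt_mul_left hlt hc.le
    exact ⟨hlt'.trans hyj, hlt'⟩

theorem IsGauge.mem_stableSet_of_dist_le (h : IsGauge g ρ) {z : X} (hy : y ∈ stableSet g ρ x)
    (hz : dist z x ≤ dist y x) : z ∈ stableSet g ρ x := by
  by_contra hzs
  obtain ⟨k, -, hk⟩ := h.exists_exit hzs
  exact (hk y (hy k)).2.not_ge hz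

theorem IsGauge.exists_ge_forall_dist_symm_lt (h : IsGauge g ρ) (hρ : 0 < ρ)
    (hx : stableSet g ρ x ∉ 𝓝 x) (m : ℕ) :
    ∃ k ≥ m, ∀ w ∈ Metric.ball (g^[k] x) ρ, ∀ j ≤ k,
      dist (g.symm^[j] w) (g.symm^[j] (g^[k] x)) < ρ := by
  have hclose : ∀ᶠ y in 𝓝 x, ∀ j ∈ Set.Iio m, dist (g^[j] y) (g^[j] x) < ρ :=
    (Filter.eventually_all_finite (Set.finite_Iio m)).2 fun j _ =>
      (g.continuous.iterate j).continuousAt.eventually (Metric.ball_mem_nhds _ hρ)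
  obtain ⟨y, hy, hym⟩ := ((Filter.not_eventually.1 hx).and_eventually hclose).exists
  obtain ⟨k, hk, hkz⟩ := h.exists_exit hy
  refine ⟨k, not_lt.1 fun hkm => (hym k hkm).not_ge hk, fun w hw j hj => ?_⟩
  obtain ⟨z, rfl⟩ := g.surjective.iterate k w
  have hleft : Function.LeftInverse g.symm g := g.symm_apply_apply
  have hsymm : ∀ u, g.symm^[j] (g^[k] u) = g^[k - j] u := fun u => by
    rw [← hleft.iterate j (g^[k - j] u), ← Function.iterate_add_apply, Nat.add_sub_cancel' hj]
  rw [hsymm, hsymm]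
  exact (hkz z hw).1 (k - j) (Nat.sub_le k j)

variable [IsUltrametricDist X]

theorem IsGauge.isOpen_stableSet (h : IsGauge g ρ) (hx : stableSet g ρ x ∈ 𝓝 x) :
    IsOpen (stableSet g ρ x) := by
  refine isOpen_iff_mem_nhds.2 fun y hy => ?_
  rcases eq_or_ne y x with rfl | hyx
  · exact hx
  · filter_upwards [Metric.ball_mem_nhds y (dist_pos.2 hyx)] with z hz
    exact h.mem_stableSet_of_dist_le hy
      ((dist_triangle_max z y x).trans (max_le (Metric.mem_ball.1 hz).le le_rfl))

variable [CompactSpace X]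

theorem IsGauge.exists_ball_subset_stableSet (h : IsGauge g ρ) (hx : stableSet g ρ x ∈ 𝓝 x) :
    ∃ k, Metric.ball (g^[k] x) ρ ⊆ stableSet g ρ (g^[k] x) := by
  rcases (stableSet g ρ x)ᶜ.eq_empty_or_nonempty with hempty | hne
  · exact ⟨0, by simp [Set.compl_empty_iff.1 hempty]⟩
  obtain ⟨y, hy, hmin⟩ := (h.isOpen_stableSet hx).isClosed_compl.isCompact.exists_isMinOn
    hne (f := fun y => dist y x) (by fun_prop)
  obtain ⟨k, -, hk⟩ := h.exists_exit hy
  refine ⟨k, fun w hw => ?_⟩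
  obtain ⟨z, rfl⟩ := g.surjective.iterate k w
  exact stableSet_iterate (not_not.1 fun hz => (hk z hw).2.not_ge (hmin hz)) k

end StableSet

theorem mapsTo_of_preimage_symm_eq {X : Type*} [TopologicalSpace X] {g : X ≃ₜ X} {A : Set X}
    (h : g.symm ⁻¹' A = A) : Set.MapsTo g A A :=
  Set.mapsTo_iff_image_subset.2 (g.preimage_symm ▸ h).subset

section Recurrence

variable {X : Type*} [MetricSpace X]

/-- The iterates of `g` map `U` into ever smaller neighbourhoods of `Φ`. -/
def IsAttractedTo (g : X → X) (U Φ : Set X) : Prop :=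
  ∀ ε > 0, ∀ᶠ n in Filter.atTop, Set.MapsTo g^[n] U (Metric.thickening ε Φ)

/-- For every `ε` there is an iterate of `g` all of whose powers are `ε`-close to the identity
on `C`. -/
def IsRecurrentOn (g : X → X) (C : Set X) : Prop :=
  ∀ ε > 0, ∃ N ≥ 1, ∀ m, ∀ u ∈ C, dist (g^[N * m] u) u < ε

theorem IsAttractedTo.mono {g : X → X} {U Φ Ψ : Set X} (h : IsAttractedTo g U Φ) (hΦ : Φ ⊆ Ψ) :
    IsAttractedTo g U Ψ := fun ε hε =>
  (h ε hε).mono fun _ hn => hn.mono_right (Metric.thickening_subset_of_subset ε hΦ)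

theorem IsAttractedTo.preimage_iterate {g : X → X} {U Φ : Set X} (h : IsAttractedTo g U Φ) (k : ℕ) :
    IsAttractedTo g (g^[k] ⁻¹' U) Φ := fun ε hε => by
  filter_upwards [(Filter.tendsto_sub_atTop_nat k).eventually (h ε hε),
    Filter.eventually_ge_atTop k] with n hn hkn u hu
  simpa only [← Function.iterate_add_apply, Nat.sub_add_cancel hkn] using hn hu

theorem IsAttractedTo.of_isCompact {g : X → X} {C Φ : Set X} (hC : IsCompact C)
    (h : ∀ x ∈ C, ∃ U ∈ 𝓝 x, IsAttractedTo g U Φ) : IsAttractedTo g C Φ := by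
  refine hC.induction_on (p := fun s => IsAttractedTo g s Φ) ?_ ?_ ?_ ?_
  · exact fun ε _ => Filter.Eventually.of_forall fun n => Set.mapsTo_empty _ _
  · exact fun s t hst ht ε hε => (ht ε hε).mono fun n hn => hn.mono_left hst
  · exact fun s t hs ht ε hε => ((hs ε hε).and (ht ε hε)).mono fun n hn => hn.1.union hn.2
  · intro x hx
    obtain ⟨U, hU, hatt⟩ := h x hx
    exact ⟨U, mem_nhdsWithin_of_mem_nhds hU, hatt⟩

theorem IsRecurrentOn.of_iterate {g : X → X} {C : Set X} {p : ℕ} (h : IsRecurrentOn g^[p] C)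
    (hp : 0 < p) : IsRecurrentOn g C := fun ε hε => by
  obtain ⟨N, hN, h⟩ := h ε hε
  refine ⟨p * N, Nat.mul_pos hp hN, fun m u hu => ?_⟩
  rw [mul_assoc, Function.iterate_mul]
  exact h m u hu

theorem IsRecurrentOn.image_eq {g : X → X} {C : Set X} (h : IsRecurrentOn g C)
    (hg : Set.MapsTo g C C) (hC : IsClosed (g '' C)) : g '' C = C := by
  refine hg.image_subset.antisymm fun x hx => hC.closure_subset (Metric.mem_closure_iff.2 ?_)
  intro ε hε
  obtain ⟨N, hN, h⟩ := h ε hε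
  obtain ⟨n, rfl⟩ := Nat.exists_eq_add_of_le' hN
  refine ⟨g (g^[n] x), ⟨_, hg.iterate n hx, rfl⟩, ?_⟩
  rw [← Function.iterate_succ_apply' g, dist_comm]
  simpa only [mul_one] using h 1 x hx

theorem IsRecurrentOn.union {g : X → X} {C D : Set X} (hC : IsRecurrentOn g C)
    (hD : IsRecurrentOn g D) : IsRecurrentOn g (C ∪ D) := by
  intro ε hε
  obtain ⟨M, hM, hMC⟩ := hC ε hε
  obtain ⟨N, hN, hND⟩ := hD ε hε
  refine ⟨M * N, Nat.mul_pos hM hN, fun m u hu => ?_⟩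
  rcases hu with hu | hu
  · rw [mul_assoc]
    exact hMC _ u hu
  · rw [mul_comm M, mul_assoc]
    exact hND _ u hu

theorem IsRecurrentOn.biUnion {ι : Type*} {g : X → X} {s : Set ι} (hs : s.Finite) {C : ι → Set X}
    (h : ∀ i ∈ s, IsRecurrentOn g (C i)) : IsRecurrentOn g (⋃ i ∈ s, C i) := by
  induction s, hs using Set.Finite.induction_on with
  | empty => exact fun ε _ => ⟨1, le_rfl, by simp⟩
  | insert _ _ ih =>
    rw [Set.biUnion_insert]
    exact (h _ (Set.mem_insert _ _)).union (ih fun i hi => h i (Set.mem_insert_of_mem _ hi))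

theorem IsRecurrentOn.symm {g : X ≃ₜ X} {C : Set X} (h : IsRecurrentOn g C)
    (hC : Set.MapsTo g.symm C C) : IsRecurrentOn g.symm C := fun ε hε => by
  obtain ⟨N, hN, hNC⟩ := h ε hε
  refine ⟨N, hN, fun m u hu => ?_⟩
  have hleft : Function.LeftInverse g g.symm := g.apply_symm_apply
  have hsymm := hNC m (g.symm^[N * m] u) (hC.iterate (N * m) hu)
  rwa [hleft.iterate (N * m) u, dist_comm] at hsymm

theorem IsRecurrentOn.preimage_iterate [CompactSpace X] {g : X ≃ₜ X} {C : Set X}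
    (h : IsRecurrentOn g C) (j : ℕ) : IsRecurrentOn g (g^[j] ⁻¹' C) := fun ε hε => by
  obtain ⟨η, hη, -, hj⟩ := exists_le_forall_dist_lt_of_uniformContinuous
    (CompactSpace.uniformContinuous_of_continuous (g.symm.continuous.iterate j)) hε
  obtain ⟨N, hN, hNC⟩ := h η hη
  refine ⟨N, hN, fun m u hu => ?_⟩
  have hleft : Function.LeftInverse g.symm g := g.symm_apply_apply
  have hclose := hj _ _ (hNC m _ hu)
  rwa [← Function.iterate_add_apply, add_comm, Function.iterate_add_apply,
    hleft.iterate j, hleft.iterate j] at hclose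

/-- A finite set `Φ` and a clopen recurrent set `K`, both completely invariant, which together
describe the limiting behaviour of the iterates of `g`. -/
structure IsLimitPair (g : X → X) (Φ K : Set X) : Prop where
  finite : Φ.Finite
  preimage_finite : g ⁻¹' Φ = Φ
  isClopen : IsClopen K
  preimage_clopen : g ⁻¹' K = K
  isRecurrentOn : IsRecurrentOn g K

theorem IsLimitPair.biUnion {ι : Type*} {g : X → X} {s : Set ι} (hs : s.Finite) {Φ K : ι → Set X}
    (h : ∀ i ∈ s, IsLimitPair g (Φ i) (K i)) :
    IsLimitPair g (⋃ i ∈ s, Φ i) (⋃ i ∈ s, K i) where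
  finite := hs.biUnion fun i hi => (h i hi).finite
  preimage_finite := by
    simp only [Set.preimage_iUnion]
    exact Set.iUnion₂_congr fun i hi => (h i hi).preimage_finite
  isClopen := hs.isClopen_biUnion fun i hi => (h i hi).isClopen
  preimage_clopen := by
    simp only [Set.preimage_iUnion]
    exact Set.iUnion₂_congr fun i hi => (h i hi).preimage_clopen
  isRecurrentOn := IsRecurrentOn.biUnion hs fun i hi => (h i hi).isRecurrentOn

end Recurrence

section Trichotomy

variable {X : Type*} [MetricSpace X] {g : X ≃ₜ X} {B : Set X} {p : ℕ}

theorem finite_range_iterate_of_isPeriodicPt {α : Type*} {f : α → α} {a : α} (hp : 0 < p)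
    (ha : Function.IsPeriodicPt f p a) : (Set.range fun j => f^[j] a).Finite := by
  refine ((Set.finite_Iio p).image fun j => f^[j] a).subset ?_
  rintro _ ⟨j, rfl⟩
  exact ⟨j % p, Nat.mod_lt j hp, ha.iterate_mod_apply j⟩

theorem image_range_iterate_of_isPeriodicPt {α : Type*} {f : α → α} {a : α} (hp : 0 < p)
    (ha : Function.IsPeriodicPt f p a) :
    f '' (Set.range fun j => f^[j] a) = Set.range fun j => f^[j] a := by
  refine Set.Subset.antisymm ?_ ?_
  · rintro _ ⟨_, ⟨j, rfl⟩, rfl⟩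
    exact ⟨j + 1, Function.iterate_succ_apply' f j a⟩
  · rintro _ ⟨j, rfl⟩
    refine ⟨_, ⟨j + (p - 1), rfl⟩, ?_⟩
    rw [← Function.iterate_succ_apply' f, Nat.succ_eq_add_one, add_assoc, Nat.sub_add_cancel hp,
      Function.iterate_add_apply, ha]

theorem ScalesDistOn.exists_le_one {f : X → X} {c : ℝ} (h : ScalesDistOn f B c)
    (hf : Set.MapsTo f B B) (hB : Bornology.IsBounded B) : ∃ d ≤ 1, ScalesDistOn f B d := by
  rcases le_or_gt c 1 with hc | hc
  · exact ⟨c, hc, h⟩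
  suffices hzero : ∀ u ∈ B, ∀ v ∈ B, dist u v = 0 from
    ⟨1, le_rfl, one_pos, fun u hu v hv => by
      rw [h.2 u hu v hv, hzero u hu v hv, mul_zero, mul_zero]⟩
  intro u hu v hv
  obtain ⟨D, hD⟩ := Metric.isBounded_iff.1 hB
  by_contra hne
  have hpos : 0 < dist u v := dist_nonneg.lt_of_ne' hne
  obtain ⟨m, hm⟩ := pow_unbounded_of_one_lt (D / dist u v) hc
  refine ((div_lt_iff₀ hpos).1 hm).not_ge ?_
  rw [← (h.iterate hf m).2 u hu v hv]
  exact hD (hf.iterate m hu) (hf.iterate m hv)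

theorem ScalesDistOn.isRecurrentOn [IsUltrametricDist X] {f : X → X} (h : ScalesDistOn f B 1)
    (hf : Set.MapsTo f B B) (hB : IsCompact B) : IsRecurrentOn f B := fun ε hε => by
  have : CompactSpace B := isCompact_iff_compactSpace.1 hB
  have hiso : Isometry (hf.restrict f B B) := Isometry.of_dist_eq fun u v =>
    (h.2 u u.2 v v.2).trans (one_mul _)
  obtain ⟨N, hN, hclose⟩ := exists_forall_dist_iterate_lt_of_isometry hiso hε
  refine ⟨N, hN, fun m u hu => ?_⟩
  have hmu := hclose m ⟨u, hu⟩
  rwa [hf.iterate_restrict] at hmu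

theorem exists_isLimitPair_of_isRecurrentOn [CompactSpace X] (hB : IsClopen B) (hp : 0 < p)
    (hmaps : Set.MapsTo g^[p] B B) (h : IsRecurrentOn g^[p] B) :
    ∃ K, B ⊆ K ∧ IsLimitPair g ∅ K := by
  have hper : Function.IsPeriodicPt (Set.preimage g) p B := by
    have himage := h.image_eq hmaps (hB.isClosed.isCompact.image (g.continuous.iterate p)).isClosed
    rw [Function.IsPeriodicPt, Function.IsFixedPt, ← Set.preimage_iterate_eq]
    exact (Set.preimage_eq_iff_eq_image (g.bijective.iterate p)).2 himage.symm
  have hfin := finite_range_iterate_of_isPeriodicPt hp hper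
  refine ⟨⋃₀ Set.range fun j => (Set.preimage g)^[j] B, Set.subset_sUnion_of_mem ⟨0, rfl⟩,
    Set.finite_empty, Set.preimage_empty, ?_, ?_, ?_⟩
  · rw [Set.sUnion_eq_biUnion]
    refine hfin.isClopen_biUnion ?_
    rintro _ ⟨j, rfl⟩
    simpa only [← Set.preimage_iterate_eq] using hB.preimage (g.continuous.iterate j)
  · rw [Set.preimage_sUnion, ← Set.sUnion_image, image_range_iterate_of_isPeriodicPt hp hper]
  · rw [Set.sUnion_eq_biUnion]
    refine IsRecurrentOn.biUnion hfin ?_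
    rintro _ ⟨j, rfl⟩
    simpa only [← Set.preimage_iterate_eq] using (h.of_iterate hp).preimage_iterate j

theorem isAttractedTo_range_iterate [CompactSpace X] {f : X → X} (hf : Continuous f) {a : X}
    (hp : 0 < p) (h : ∀ ε > 0, ∀ᶠ m in Filter.atTop, ∀ u ∈ B, dist ((f^[p])^[m] u) a < ε) :
    IsAttractedTo f B (Set.range fun j => f^[j] a) := fun ε hε => by
  have hj : ∀ᶠ m in Filter.atTop, ∀ j ∈ Set.Iio p, ∀ u ∈ B,
      dist (f^[j] ((f^[p])^[m] u)) (f^[j] a) < ε := by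
    refine (Filter.eventually_all_finite (Set.finite_Iio p)).2 fun j _ => ?_
    obtain ⟨η, hη, -, hj⟩ := exists_le_forall_dist_lt_of_uniformContinuous
      (CompactSpace.uniformContinuous_of_continuous (hf.iterate j)) hε
    exact (h η hη).mono fun m hm u hu => hj _ _ (hm u hu)
  filter_upwards [(Nat.tendsto_div_const_atTop hp.ne').eventually hj] with n hn u hu
  refine Metric.mem_thickening_iff.2 ⟨_, ⟨n % p, rfl⟩, ?_⟩
  have hdist := hn (n % p) (Nat.mod_lt n hp) u hu
  rwa [← Function.iterate_mul, ← Function.iterate_add_apply, Nat.mod_add_div] at hdist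

theorem exists_isLimitPair_of_contracting [CompactSpace X] {c : ℝ} (hB : IsClosed B)
    (hne : B.Nonempty) (hp : 0 < p) (hmaps : Set.MapsTo g^[p] B B) (h : ScalesDistOn g^[p] B c)
    (hc : c < 1) : ∃ Φ, IsLimitPair g Φ ∅ ∧ IsAttractedTo g B Φ := by
  obtain ⟨x, hx⟩ := hne
  have hcontr : ContractingWith ⟨c, h.1.le⟩ (hmaps.restrict g^[p] B B) :=
    ⟨hc, LipschitzWith.of_dist_le_mul fun u v => (h.2 u u.2 v v.2).le⟩
  obtain ⟨a, haB, ha, -, -⟩ :=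
    hcontr.exists_fixedPoint' hB.isComplete hmaps hx (edist_ne_top _ _)
  have hper : Function.IsPeriodicPt g p a := ha
  refine ⟨Set.range fun j => g^[j] a, ⟨finite_range_iterate_of_isPeriodicPt hp hper, ?_,
    isClopen_empty, Set.preimage_empty, fun ε _ => ⟨1, le_rfl, by simp⟩⟩, ?_⟩
  · rw [Set.preimage_eq_iff_eq_image g.bijective, image_range_iterate_of_isPeriodicPt hp hper]
  · refine isAttractedTo_range_iterate g.continuous hp fun ε hε => ?_
    obtain ⟨D, hD⟩ := Metric.isBounded_iff.1 hB.isCompact.isBounded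
    have hlim : Filter.Tendsto (fun m => c ^ m * D) Filter.atTop (𝓝 0) := by
      simpa using (tendsto_pow_atTop_nhds_zero_of_lt_one h.1.le hc).mul_const D
    filter_upwards [hlim.eventually_lt_const hε] with m hm u hu
    calc dist ((g^[p])^[m] u) a = dist ((g^[p])^[m] u) ((g^[p])^[m] a) := by
          rw [(ha.iterate m).eq]
      _ = c ^ m * dist u a := (h.iterate hmaps m).2 u hu a haB
      _ ≤ c ^ m * D := mul_le_mul_of_nonneg_left (hD hu haB) (pow_nonneg h.1.le m)
      _ < ε := hm

variable [CompactSpace X] [IsUltrametricDist X] {ρ : ℝ} {x y : X}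

theorem IsGauge.exists_isLimitPair_of_ball_subset (h : IsGauge g ρ) (hρ : 0 < ρ)
    (hy : Metric.ball y ρ ⊆ stableSet g ρ y) (hp : 0 < p) (hpy : dist (g^[p] y) y < ρ) :
    ∃ Φ K, IsLimitPair g Φ K ∧ (Metric.ball y ρ ⊆ K ∨ IsAttractedTo g (Metric.ball y ρ) Φ) := by
  have hclopen : IsClopen (Metric.ball y ρ) := IsUltrametricDist.isClopen_ball y ρ
  have hmaps : Set.MapsTo g^[p] (Metric.ball y ρ) (Metric.ball y ρ) := fun u hu =>
    IsUltrametricDist.ball_eq_of_mem hpy ▸ hy hu p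
  obtain ⟨c, hc⟩ := h.exists_scalesDistOn_stableSet y p
  obtain ⟨d, hd, hscale⟩ := (hc.mono hy).exists_le_one hmaps Metric.isBounded_ball
  rcases hd.lt_or_eq with hd | rfl
  · obtain ⟨Φ, hΦ, hatt⟩ := exists_isLimitPair_of_contracting hclopen.isClosed
      (Metric.nonempty_ball.2 hρ) hp hmaps hscale hd
    exact ⟨Φ, ∅, hΦ, Or.inr hatt⟩
  · obtain ⟨K, hK, hlim⟩ := exists_isLimitPair_of_isRecurrentOn hclopen hp hmaps
      (hscale.isRecurrentOn hmaps hclopen.isClosed.isCompact)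
    exact ⟨∅, K, hlim, Or.inl hK⟩

theorem finite_range_ball (hρ : 0 < ρ) : (Set.range fun x : X => Metric.ball x ρ).Finite := by
  obtain ⟨t, -, ht, hcover⟩ := finite_cover_balls_of_compact (isCompact_univ (X := X)) hρ
  refine (ht.image fun x => Metric.ball x ρ).subset ?_
  rintro _ ⟨x, rfl⟩
  obtain ⟨y, hy, hxy⟩ := Set.mem_iUnion₂.1 (hcover (Set.mem_univ x))
  exact ⟨y, hy, IsUltrametricDist.ball_eq_of_mem hxy⟩

theorem IsGauge.exists_recurrent_ball (h : IsGauge g ρ) (hρ : 0 < ρ)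
    (hx : stableSet g ρ x ∈ 𝓝 x) : ∃ k, Metric.ball (g^[k] x) ρ ⊆ stableSet g ρ (g^[k] x) ∧
      ∃ p > 0, dist (g^[p] (g^[k] x)) (g^[k] x) < ρ := by
  have hinf : {k | Metric.ball (g^[k] x) ρ ⊆ stableSet g ρ (g^[k] x)}.Infinite := by
    refine Nat.frequently_atTop_iff_infinite.1 (Filter.frequently_atTop.2 fun n => ?_)
    have hopen : IsOpenMap g^[n] := coe_homeomorph_pow g n ▸ (g ^ n).isOpenMap
    obtain ⟨k, hk⟩ := h.exists_ball_subset_stableSet (x := g^[n] x) <|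
      Filter.mem_of_superset (hopen.image_mem_nhds hx)
        (Set.image_subset_iff.2 fun y hy => stableSet_iterate hy n)
    rw [← Function.iterate_add_apply] at hk
    exact ⟨k + n, Nat.le_add_left n k, hk⟩
  obtain ⟨k, hk, j, -, hkj, hball⟩ := hinf.exists_lt_map_eq_of_mapsTo
    (f := fun k => Metric.ball (g^[k] x) ρ) (fun k _ => Set.mem_range_self (g^[k] x))
    (finite_range_ball hρ)
  refine ⟨k, hk, j - k, Nat.sub_pos_of_lt hkj, ?_⟩
  rw [← Function.iterate_add_apply, Nat.sub_add_cancel hkj.le]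
  exact hball.ge (Metric.mem_ball_self hρ)

theorem IsGauge.exists_isLimitPair (h : IsGauge g ρ) (hρ : 0 < ρ) :
    ∃ Φ K, IsLimitPair g Φ K ∧ ∀ x, stableSet g ρ x ∈ 𝓝 x →
      x ∈ K ∨ ∃ U ∈ 𝓝 x, IsAttractedTo g U Φ := by
  set s := {B | ∃ y, B = Metric.ball y ρ ∧ Metric.ball y ρ ⊆ stableSet g ρ y ∧
    ∃ p > 0, dist (g^[p] y) y < ρ}
  have hs : s.Finite := (finite_range_ball hρ).subset fun B ⟨y, hB, _⟩ => ⟨y, hB.symm⟩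
  have hlim : ∀ B ∈ s, ∃ Φ K, IsLimitPair g Φ K ∧ (B ⊆ K ∨ IsAttractedTo g B Φ) := by
    rintro _ ⟨y, rfl, hy, p, hp, hpy⟩
    exact h.exists_isLimitPair_of_ball_subset hρ hy hp hpy
  choose! Φ K hpair hball using hlim
  have hunion := IsLimitPair.biUnion hs hpair
  refine ⟨_, _, hunion, fun x hx => ?_⟩
  obtain ⟨k, hk, p, hp, hpk⟩ := h.exists_recurrent_ball hρ hx
  have hmem : Metric.ball (g^[k] x) ρ ∈ s := ⟨_, rfl, hk, p, hp, hpk⟩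
  rcases hball _ hmem with hK | hatt
  · left
    refine (Function.IsFixedPt.preimage_iterate hunion.preimage_clopen k).subset ?_
    exact Set.subset_biUnion_of_mem (u := K) hmem (hK (Metric.mem_ball_self hρ))
  · right
    exact ⟨_, (g.continuous.iterate k).continuousAt.preimage_mem_nhds (Metric.ball_mem_nhds _ hρ),
      (hatt.mono (Set.subset_biUnion_of_mem (u := Φ) hmem)).preimage_iterate k⟩

end Trichotomy

section Limits

variable {X : Type*} [MetricSpace X] [CompactSpace X] [IsUltrametricDist X] {g : X ≃ₜ X} {ρ : ℝ}
  {x : X}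

theorem IsGauge.mem_union_of_stableSet_notMem_nhds (h : IsGauge g ρ) (hρ : 0 < ρ) {R K : Set X}
    (hlim : IsLimitPair g.symm R K) (hsymm : ∀ s, stableSet g.symm ρ s ∈ 𝓝 s →
      s ∈ K ∨ ∃ U ∈ 𝓝 s, IsAttractedTo g.symm U R)
    (hx : stableSet g ρ x ∉ 𝓝 x) : x ∈ R ∪ K := by
  choose k hk hback using h.exists_ge_forall_dist_symm_lt hρ hx
  have hk : Filter.Tendsto k Filter.atTop Filter.atTop :=
    Filter.tendsto_atTop_mono hk Filter.tendsto_id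
  obtain ⟨s, φ, hφ, hs⟩ := CompactSpace.tendsto_subseq fun m => g^[k m] x
  have hkφ := hk.comp hφ.tendsto_atTop
  have hstable : Metric.ball s ρ ⊆ stableSet g.symm ρ s := fun w hw j => by
    obtain ⟨i, his, hij⟩ := ((hs.eventually (Metric.ball_mem_nhds s hρ)).and
      (hkφ.eventually_ge_atTop j)).exists
    have hball := IsUltrametricDist.ball_eq_of_mem his
    exact (dist_triangle_max _ _ _).trans_lt <| max_lt
      (hback (φ i) w (hball ▸ hw) j hij)
      (by rw [dist_comm]; exact hback (φ i) s (hball ▸ Metric.mem_ball_self hρ) j hij)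
  have hleft : Function.LeftInverse g.symm g := g.symm_apply_apply
  have hsnhds := Filter.mem_of_superset (Metric.ball_mem_nhds s hρ) hstable
  rcases hsymm s hsnhds with hsK | ⟨U, hU, hatt⟩
  · right
    obtain ⟨i, hi⟩ := (hs.eventually (hlim.isClopen.isOpen.mem_nhds hsK)).exists
    rw [← hleft.iterate (k (φ i)) x]
    exact (Function.IsFixedPt.preimage_iterate hlim.preimage_clopen _).ge hi
  · left
    rw [← hlim.finite.isClosed.closure_eq, Metric.closure_eq_iInter_thickening]
    refine Set.mem_iInter₂.2 fun ε hε => ?_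
    obtain ⟨i, hi, hiU⟩ := ((hkφ.eventually (hatt ε hε)).and (hs.eventually hU)).exists
    rw [← hleft.iterate (k (φ i)) x]
    exact hi hiU

theorem IsLocalHomothety.exists_limit_sets (hg : IsLocalHomothety g) :
    ∃ R Φ K : Set X, R.Finite ∧ Φ.Finite ∧ IsClopen K ∧ IsRecurrentOn g K ∧ Set.MapsTo g R R ∧
      ∀ x ∉ K, x ∉ R → ∃ U ∈ 𝓝 x, IsAttractedTo g U Φ := by
  obtain ⟨ρ, hρ, h⟩ := hg.exists_isGauge
  obtain ⟨Φ, K, hlim, hstable⟩ := h.exists_isLimitPair hρ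
  obtain ⟨R, L, hlim', hstable'⟩ := h.symm.exists_isLimitPair hρ
  refine ⟨R, Φ, K ∪ L, hlim'.finite, hlim.finite, hlim.isClopen.union hlim'.isClopen,
    hlim.isRecurrentOn.union
      (hlim'.isRecurrentOn.symm (mapsTo_of_preimage_symm_eq hlim'.preimage_clopen)),
    mapsTo_of_preimage_symm_eq hlim'.preimage_finite, fun x hx hxR => ?_⟩
  by_cases hxs : stableSet g ρ x ∈ 𝓝 x
  · exact (hstable x hxs).resolve_left fun hxK => hx (Or.inl hxK)
  · exact absurd (h.mem_union_of_stableSet_notMem_nhds hρ hlim' hstable' hxs)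
      fun hxRL => hxRL.elim hxR fun hxL => hx (Or.inr hxL)

theorem IsLocalHomothety.exists_collapses (hg : IsLocalHomothety g) :
    ∃ K, IsClosed K ∧ Collapses (positivePowers g) K := by
  obtain ⟨R, Φ, K, hR, hΦ, hK, hrec, hgR, hatt⟩ := hg.exists_limit_sets
  refine ⟨K, hK.isClosed, R, Φ ∪ R, hR, hΦ.union hR, fun ε hε => ?_⟩
  have hC : IsCompact (K ∪ Metric.thickening ε R)ᶜ :=
    (hK.isOpen.union Metric.isOpen_thickening).isClosed_compl.isCompact
  obtain ⟨m, hm⟩ := Filter.eventually_atTop.1 (IsAttractedTo.of_isCompact hC (fun x hx =>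
    hatt x (fun hxK => hx (Or.inl hxK))
      fun hxR => hx (Or.inr (Metric.self_subset_thickening hε R hxR))) ε hε)
  obtain ⟨N, hN, hNK⟩ := hrec ε hε
  refine ⟨g ^ (N * (m + 1)), ⟨_, Nat.mul_pos hN m.succ_pos, rfl⟩, fun x hx hxR => ?_,
    fun x hx => coe_homeomorph_pow g _ ▸ hNK (m + 1) x hx⟩
  rw [coe_homeomorph_pow]
  by_cases hxR' : x ∈ Metric.thickening ε R
  · obtain ⟨r, hr, hxr⟩ := Metric.mem_thickening_iff.1 hxR'
    refine ⟨_, Or.inr (hgR.iterate (N * (m + 1)) hr), ?_⟩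
    rw [hxR r hr hxr, dist_self]
    exact hε
  · have hmN : m ≤ N * (m + 1) := (Nat.le_succ m).trans (Nat.le_mul_of_pos_left _ hN)
    obtain ⟨φ, hφ, hxφ⟩ :=
      Metric.mem_thickening_iff.1 (hm _ hmN fun hx' => hx'.elim hx hxR')
    exact ⟨φ, Or.inl hφ, hxφ⟩

end Limits

section TitsAlternative

variable {X : Type*} [MetricSpace X]

theorem not_collapses_of_dist_iterate_lt [IsUltrametricDist X] {g : X ≃ₜ X} {K : Set X} {y y' : X}
    (hy : y ∈ K) (hy' : y' ∈ K) (h : ∀ n ≥ 1, dist (g^[n] y) (g^[n] y') < dist y y') :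
    ¬ Collapses (positivePowers g) K := by
  rintro ⟨R, Φ, -, -, hcol⟩
  obtain ⟨_, ⟨n, hn, rfl⟩, -, hid⟩ := hcol (dist y y') (dist_nonneg.trans_lt (h 1 le_rfl))
  rw [coe_homeomorph_pow] at hid
  refine lt_irrefl (dist y y') ?_
  calc dist y y' ≤ max (dist y (g^[n] y)) (dist (g^[n] y) y') := dist_triangle_max _ _ _
    _ ≤ max (dist y (g^[n] y)) (max (dist (g^[n] y) (g^[n] y')) (dist (g^[n] y') y')) :=
      max_le_max_left _ (dist_triangle_max _ _ _)
    _ < dist y y' := max_lt (dist_comm y _ ▸ hid y hy) (max_lt (h n hn) (hid y' hy'))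

/-- The closed sets outside of which positive powers of some element of `H` are collapsing. -/
def collapseSets (H : Subgroup (X ≃ₜ X)) : Set (Set X) :=
  {K | IsClosed K ∧ ∃ g ∈ H, Collapses (positivePowers g) K}

variable [CompactSpace X]

theorem image_mem_collapseSets {H : Subgroup (X ≃ₜ X)} {K : Set X} (hK : K ∈ collapseSets H)
    {k : X ≃ₜ X} (hk : k ∈ H) : k '' K ∈ collapseSets H := by
  obtain ⟨hclosed, g, hg, hcol⟩ := hK
  exact ⟨k.isClosed_image.2 hclosed, k * g * k⁻¹, H.mul_mem (H.mul_mem hk hg) (H.inv_mem hk),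
    hcol.conj k⟩

theorem isClosedInvariant_sInter_collapseSets {H : Subgroup (X ≃ₜ X)}
    (hne : (⋂₀ collapseSets H).Nonempty) : IsClosedInvariant H (⋂₀ collapseSets H) where
  isClosed := isClosed_sInter fun K hK => hK.1
  nonempty := hne
  mapsTo k hk x hx K hK := by
    obtain ⟨y, hy, rfl⟩ := hx _ (image_mem_collapseSets hK (H.inv_mem hk))
    simpa using hy

variable [IsUltrametricDist X]

theorem collapses_empty_of_sInter_collapseSets_eq_empty {H : Subgroup (X ≃ₜ X)}
    (h : ⋂₀ collapseSets H = ∅) : Collapses (H : Set (X ≃ₜ X)) ∅ := by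
  rw [Set.sInter_eq_iInter] at h
  obtain ⟨t, ht⟩ := isCompact_univ.elim_finite_subfamily_closed
    (fun K : collapseSets H => (K : Set X)) (fun K => K.2.1) (by rw [h, Set.inter_empty])
  have hempty : ⋂₀ (Subtype.val '' (t : Set (collapseSets H))) = ∅ := by
    simpa [Set.sInter_image] using ht
  rw [← hempty]
  refine collapses_sInter (t.finite_toSet.image _) ?_
  rintro _ ⟨⟨K, -, g, hg, hK⟩, -, rfl⟩
  refine hK.mono ?_
  rintro _ ⟨n, -, rfl⟩
  exact H.pow_mem hg n

variable [MeasurableSpace X] [BorelSpace X]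

theorem exists_isPingPongPair_of_finite {S : Set (X ≃ₜ X)} (hS : S.Finite)
    (hloc : ∀ g ∈ Subgroup.closure S, IsLocalHomothety g)
    (hpres : ¬ PreservesRegularProbability (Subgroup.closure S)) :
    ∃ g ∈ Subgroup.closure S, ∃ h ∈ Subgroup.closure S, IsPingPongPair g h := by
  rcases (⋂₀ collapseSets (Subgroup.closure S)).eq_empty_or_nonempty with hempty | hne
  · obtain ⟨R, Φ, hR, hΦ, h⟩ :=
      (collapses_empty_of_sInter_collapseSets_eq_empty hempty).exists_image_compl_subset
    exact exists_isPingPongPair_of_image_compl_subset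
      (infinite_orbit_of_not_preservesRegularProbability hpres) hR hΦ h
  · exfalso
    obtain ⟨M, hMsub, hM⟩ :=
      (isClosedInvariant_sInter_collapseSets hne).exists_isMinimalSet_subset
    obtain ⟨g, hg, y, hy, y', hy', hlt⟩ := hM.exists_contracting_of_not_preserves hS hloc hpres
    obtain ⟨K, hK, hcol⟩ := (hloc g hg).exists_collapses
    have hMK : M ⊆ K := hMsub.trans (Set.sInter_subset_of_mem ⟨hK, g, hg, hcol⟩)
    exact not_collapses_of_dist_iterate_lt (hMK hy) (hMK hy') hlt hcol

theorem dynamicalTitsAlternative_of_isLocalHomothety {G : Subgroup (X ≃ₜ X)}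
    (hG : ∀ g ∈ G, IsLocalHomothety g) : DynamicalTitsAlternative G := by
  refine fun H hHG => or_iff_not_imp_left.2 fun hpres => ?_
  obtain ⟨S, hSH, hS⟩ : ∃ S : Finset (X ≃ₜ X), (S : Set (X ≃ₜ X)) ⊆ H ∧
      ¬ PreservesRegularProbability (Subgroup.closure (S : Set (X ≃ₜ X))) := by
    by_contra! hfin
    exact hpres (preservesRegularProbability_of_closure_finset hfin)
  have hle : Subgroup.closure (S : Set (X ≃ₜ X)) ≤ H := (Subgroup.closure_le H).2 hSH
  obtain ⟨g, hg, h, hh, hgh⟩ := exists_isPingPongPair_of_finite S.finite_toSet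
    (fun g hg => hG g (hHG (hle hg))) hS
  exact ⟨g, hle hg, h, hle hh, hgh⟩

theorem theoremA_general [Nonempty X] (G : Subgroup (X ≃ₜ X)) (hG : ∀ g ∈ G, IsLocalHomothety g) :
    DynamicalTitsAlternative G ∧
      ∀ g ∈ G, ∀ h ∈ G, IsPingPongPair g h → Function.Injective (FreeGroup.lift ![g, h]) :=
  ⟨dynamicalTitsAlternative_of_isLocalHomothety hG,
    fun _ _ _ _ => IsPingPongPair.injective_lift⟩

end TitsAlternative

section Tree

instance isStronglyAtomic_of_isPredArchimedean {α : Type*} [PartialOrder α] [PredOrder α]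
    [IsPredArchimedean α] : IsStronglyAtomic α where
  exists_covBy_le_of_lt a b hab := by
    refine Pred.rec (P := fun x _ => x < b → ∃ y, x ⋖ y ∧ y ≤ b) (fun h => absurd h (lt_irrefl b))
      (fun x hx ih h => ?_) hab.le hab
    by_cases hmin : IsMin x
    · rw [hmin.pred_eq] at h ⊢
      exact ih h
    · exact ⟨x, Order.pred_covBy_of_not_isMin hmin, hx⟩

variable {T : RootedTree}

instance nonempty_boundary [T.LocallyFinite] [Infinite T] : Nonempty T.Boundary := by
  obtain ⟨f, h0, hf⟩ := exists_orderEmbedding_covby_of_forall_covby_finite_of_bot (α := T)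
    RootedTree.LocallyFinite.finite_children
  exact ⟨⟨f, h0, hf⟩⟩

instance isUltrametricDist_boundary : IsUltrametricDist T.Boundary where
  dist_triangle_max ξ η ζ := PiNat.dist_triangle_nonarch ξ.path η.path ζ.path

theorem isLocalHomothety_of_mem_AAut [T.LocallyFinite] {g : T.Boundary ≃ₜ T.Boundary}
    (hg : g ∈ T.AAut) : IsLocalHomothety g := by
  intro x
  obtain ⟨U, hU, c, hc⟩ := RootedTree.isAlmostAutomorphism_iff.1 hg x
  obtain ⟨r, hr, hrU⟩ := Metric.mem_nhds_iff.1 hU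
  exact ⟨r, hr, c, ScalesDistOn.mono hc hrU⟩

end Tree

theorem theoremA (T : RootedTree) [T.LocallyFinite] [Infinite T] :
    DynamicalTitsAlternative T.AAut ∧
      ∀ g ∈ T.AAut, ∀ h ∈ T.AAut, IsPingPongPair g h →
        Function.Injective (FreeGroup.lift ![g, h]) :=
  theoremA_general T.AAut fun _ => isLocalHomothety_of_mem_AAut
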